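/- Fix $t^{1/4}\in\mathbb{C}^\ast$. **Temperley–Lieb algebras.** Let $\mathrm{TL}_0=\mathbb{C}[X]$ and $\mathrm{TL}_1=\mathbb{C}[\rho,\rho^{-1}]$. For $n\ge 2$ let $\mathrm{TL}_n$ be the unital associative $\mathbb{C}$-algebra with generators $e_1,\dots,e_n,\rho,\rho^{-1}$ (indices modulo $n$) and relations $e_i^2=-(t^{1/2}+t^{-1/2})e_i$, $\rho e_i=e_{i+1}\rho$, $\rho\rho^{-1}=1=\rho^{-1}\rho$, together with $\rho^2e_1=e_1$ if $n=2$, and with $e_ie_j=e_je_i$ for $i-j\neq\pm1$, $e_ie_{i\pm1}e_i=e_i$ and $(\rho e_1)^{n-1}=\rho^n(\rho e_1)$ if $n\ge 3$. **Skein category.** Let $\mathcal{S}$ be the skein category of the annulus $A=\{1\le|z|\le2\}$. Its objects are the integers $n\ge0$. Its morphisms $m\to n$ are complex linear combinations of $(m,n)$-tangle diagrams in $A$, with $m$ marked points on the inner and $n$ marked points on the outer boundary, taken up to planar isotopy fixing the boundary, modulo the Kauffman skein relation (crossing) $=t^{1/4}$(smoothing that separates the two regions swept by rotating the over-strand counterclockwise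 onto the under-strand) $+\,t^{-1/4}$(smoothing that merges these two regions), and modulo removal of a contractible loop at the cost of the factor $-(t^{1/2}+t^{-1/2})$. The composite $D'\circ D$ is $D$ placed inside $D'$. Marked points are numbered counterclockwise from angle $0$. Let $\mathcal{I}:\mathcal{S}\to\mathcal{S}$, $n\mapsto n+1$, be the arc insertion functor: $\mathcal{I}([D])=[D^{ins}]$, where $D^{ins}$ is obtained from $D$ by inserting an arc from the inner to the outer boundary that runs along the radial segment just clockwise of the first marked point, ends at the new last marked points, and passes underneath all arcs it meets. **Identification.** Let $\Phi_n:\mathrm{TL}_n\to\mathrm{End}_{\mathcal{S}}(n)$ be the algebra map which sends * $X$ (for $n=0$) to the class of a simple closed curve around the hole of $A$; * $\rho$ (for $n\ge1$) to the class of the diagram that joins, for $1\le j<n$, the inner point $j$ to the outer point $j+1$, and the inner point $n$ to the outer point $1$, each strand turning counterclockwise by one step on its way outwards; * $e_i$ (for $n\ge2$) to the class of the diagram that joins the points $i,i+1$ (modulo $n$) at each of the two boundaries by an arc near that boundary running counterclockwise from $i$ to $i+1$, and all other inner points $j$ to the outer point $j$ by straight lines. **Statement.** There are unital algebra maps $\mathcal{I}_n:\mathrm{TL}_n\to\mathrm{TL}_{n+1}$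 $(n\ge0)$ which are arc insertion under these identifications, that is, $\Phi_{n+1}\circ\mathcal{I}_n=\mathcal{I}|_{\mathrm{End}_{\mathcal{S}}(n)}\circ\Phi_n$ for all $n$, and which are given on generators by: (a) $\mathcal{I}_0(X)=t^{1/4}\rho+t^{-1/4}\rho^{-1}$. (b) $\mathcal{I}_1(\rho)=\rho(t^{-1/4}e_1+t^{1/4})$ and $\mathcal{I}_1(\rho^{-1})=(t^{1/4}e_1+t^{-1/4})\rho^{-1}$. (c) For $n\ge2$: $$\mathcal{I}_n(e_i)=e_i\quad(1\le i\le n-1),$$ $$\mathcal{I}_n(e_n)=(t^{1/4}e_n+t^{-1/4})\,e_{n+1}\,(t^{-1/4}e_n+t^{1/4}),$$ $$\mathcal{I}_n(\rho)=\rho(t^{-1/4}e_n+t^{1/4}),\qquad \mathcal{I}_n(\rho^{-1})=(t^{1/4}e_n+t^{-1/4})\rho^{-1}.$$ -/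

import Mathlib

set_option linter.unnecessarySeqFocus false
set_option linter.unusedTactic false
set_option linter.unreachableTactic false

namespace AnnularSkein

open CategoryTheory

/-!
## Tangle diagrams in the annulus

A tangle diagram in the annulus `A = {1 ≤ |z| ≤ 2}` is put in general position with respect to the
radius and to a seam: the radial segment just clockwise of the first marked point. Each circle
`|z| = r` then meets the diagram in finitely many points, numbered counterclockwise starting from
the seam, and reading the diagram from the inner to the outer boundary gives a finite sequence of
elementary events. A path of events is a diagram in general position; two such diagrams are planar
isotopic (relative to the boundary) iff they are connected by the moves in `PlanarMove`.
-/

/-- The elementary pieces of a diagram away from the seam. Going outwards, `cup` creates two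
neighbouring points, `cap` joins two neighbouring points, and in a crossing two neighbouring strands
exchange places. `ccwOver`: the over-strand is the one that moves counterclockwise when
going outwards; `cwOver`: the over-strand is the one that moves clockwise. -/
inductive LocalPiece : Type
  | cup | cap | ccwOver | cwOver

namespace LocalPiece
/-- Number of points on the inner side. -/
@[simp] abbrev dom : LocalPiece → ℕ
  | cup => 0
  | cap => 2
  | ccwOver => 2
  | cwOver => 2
/-- Number of points on the outer side. -/
@[simp] abbrev cod : LocalPiece → ℕ
  | cup => 2
  | cap => 0
  | ccwOver => 2
  | cwOver => 2
end LocalPiece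

/-- Elementary events between a circle with `m` points and a larger one with `n` points.
`piece g a b`: the piece `g` with `a` straight strands before it and `b` straight strands after it
in the counterclockwise numbering. `seamCcw`: going outwards, the strand at the last position
crosses the seam counterclockwise and gets position `1`, the strand at position `j < n` gets position
`j + 1`. `seamCw` is the reverse of it. -/
inductive Event : ℕ → ℕ → Type
  | piece (g : LocalPiece) (a b : ℕ) {m n : ℕ} (hm : m = a + g.dom + b) (hn : n = a + g.cod + b) :
      Event m n
  | seamCcw {n : ℕ} (hn : 0 < n) : Event n n
  | seamCw {n : ℕ} (hn : 0 < n) : Event n n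

/-- A circle with `pts` marked points. -/
structure Circ : Type where
  pts : ℕ

instance : Quiver Circ := ⟨fun X Y => Event X.pts Y.pts⟩

/-- The object `n` of the category of diagrams. -/
abbrev ob (n : ℕ) : Paths Circ := (Paths.of Circ).obj ⟨n⟩

/-- `(m, n)`-tangle diagrams in general position: `m` inner and `n` outer endpoints. The composite
`D ≫ D'` is `D` placed inside `D'`. -/
abbrev Diagram (m n : ℕ) : Type := ob m ⟶ ob n

def piece (g : LocalPiece) (a b : ℕ) {m n : ℕ} (hm : m = a + g.dom + b := by first | omega | (simp only [LocalPiece.dom, LocalPiece.cod]; done) | (simp only [LocalPiece.dom, LocalPiece.cod]; omega))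
   (hn : n = a + g.cod + b := by first | omega | (simp only [LocalPiece.dom, LocalPiece.cod]; done) | (simp only [LocalPiece.dom, LocalPiece.cod]; omega)) : Diagram m n :=
  (Paths.of Circ).map (X := ⟨m⟩) (Y := ⟨n⟩) (Event.piece g a b hm hn)

def seamCcw {n : ℕ} (hn : 0 < n) : Diagram n n :=
  (Paths.of Circ).map (X := ⟨n⟩) (Y := ⟨n⟩) (Event.seamCcw hn)
def seamCw {n : ℕ} (hn : 0 < n) : Diagram n n :=
  (Paths.of Circ).map (X := ⟨n⟩) (Y := ⟨n⟩) (Event.seamCw hn)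

open LocalPiece

/-- Planar isotopy moves (no Reidemeister moves): distant pieces change their order, a maximum and a
minimum cancel, a crossing is rotated past a maximum or a minimum, and a piece or a strand passes
through the seam. -/
inductive PlanarMove : HomRel (Paths Circ)
  | interchange (f g : LocalPiece) (a c b : ℕ) {m k l n : ℕ}
      (hm : m = a + f.dom + c + g.dom + b) (hk : k = a + f.cod + c + g.dom + b)
      (hl : l = a + f.dom + c + g.cod + b) (hn : n = a + f.cod + c + g.cod + b) :
      PlanarMove
        ((piece f a (c + g.dom + b) (by omega) (by omega) : Diagram m k) ≫
          (piece g (a + f.cod + c) b (by omega) (by omega) : Diagram k n))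
        ((piece g (a + f.dom + c) b (by omega) (by omega) : Diagram m l) ≫
          (piece f a (c + g.cod + b) (by omega) (by omega) : Diagram l n))
  | zigzag_left (a b : ℕ) {m k : ℕ} (hm : m = a + 1 + b) (hk : k = a + 3 + b) :
      PlanarMove ((piece cup (a + 1) b : Diagram m k) ≫ (piece cap a (b + 1) : Diagram k m))
        (𝟙 (ob m))
  | zigzag_right (a b : ℕ) {m k : ℕ} (hm : m = a + 1 + b) (hk : k = a + 3 + b) :
      PlanarMove ((piece cup a (b + 1) : Diagram m k) ≫ (piece cap (a + 1) b : Diagram k m))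
        (𝟙 (ob m))
  | cap_ccwOver (a b : ℕ) {m n : ℕ} (hm : m = a + 3 + b) (hn : n = a + 1 + b) :
      PlanarMove ((piece ccwOver (a + 1) b : Diagram m m) ≫ (piece cap a (b + 1) : Diagram m n))
        ((piece cwOver a (b + 1) : Diagram m m) ≫ (piece cap (a + 1) b : Diagram m n))
  | cap_cwOver (a b : ℕ) {m n : ℕ} (hm : m = a + 3 + b) (hn : n = a + 1 + b) :
      PlanarMove ((piece cwOver (a + 1) b : Diagram m m) ≫ (piece cap a (b + 1) : Diagram m n))
        ((piece ccwOver a (b + 1) : Diagram m m) ≫ (piece cap (a + 1) b : Diagram m n))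
  | cup_ccwOver (a b : ℕ) {m n : ℕ} (hm : m = a + 1 + b) (hn : n = a + 3 + b) :
      PlanarMove ((piece cup a (b + 1) : Diagram m n) ≫ (piece ccwOver (a + 1) b : Diagram n n))
        ((piece cup (a + 1) b : Diagram m n) ≫ (piece cwOver a (b + 1) : Diagram n n))
  | cup_cwOver (a b : ℕ) {m n : ℕ} (hm : m = a + 1 + b) (hn : n = a + 3 + b) :
      PlanarMove ((piece cup a (b + 1) : Diagram m n) ≫ (piece cwOver (a + 1) b : Diagram n n))
        ((piece cup (a + 1) b : Diagram m n) ≫ (piece ccwOver a (b + 1) : Diagram n n))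
  | seamCcw_seamCw {n : ℕ} (hn : 0 < n) :
      PlanarMove (seamCcw hn ≫ seamCw hn) (𝟙 (ob n))
  | seamCw_seamCcw {n : ℕ} (hn : 0 < n) :
      PlanarMove (seamCw hn ≫ seamCcw hn) (𝟙 (ob n))
  | seam_piece (g : LocalPiece) (a b : ℕ) {m n : ℕ}
      (hm : m = a + g.dom + b + 1) (hn : n = a + g.cod + b + 1) :
      PlanarMove
        ((piece g a (b + 1) (by omega) (by omega) : Diagram m n) ≫ seamCcw (by omega))
        (seamCcw (by omega) ≫ (piece g (a + 1) b (by omega) (by omega) : Diagram m n))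
  | seam_cup (a : ℕ) {n : ℕ} (hn : n = a + 2) :
      PlanarMove
        ((piece cup a 0 : Diagram a n) ≫ seamCcw (by omega) ≫ seamCcw (by omega))
        (piece cup 0 a : Diagram a n)
  | seam_cap (a : ℕ) {n : ℕ} (hn : n = a + 2) :
      PlanarMove
        (seamCcw (by omega) ≫ seamCcw (by omega) ≫ (piece cap 0 a : Diagram n a))
        (piece cap a 0 : Diagram n a)
  | seam_ccwOver (a : ℕ) {n : ℕ} (hn : n = a + 2) :
      PlanarMove
        ((piece ccwOver a 0 : Diagram n n) ≫ seamCcw (by omega) ≫ seamCcw (by omega))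
        (seamCcw (by omega) ≫ seamCcw (by omega) ≫ (piece ccwOver 0 a : Diagram n n))
  | seam_cwOver (a : ℕ) {n : ℕ} (hn : n = a + 2) :
      PlanarMove
        ((piece cwOver a 0 : Diagram n n) ≫ seamCcw (by omega) ≫ seamCcw (by omega))
        (seamCcw (by omega) ≫ seamCcw (by omega) ≫ (piece cwOver 0 a : Diagram n n))

noncomputable section

/-- The category of tangle diagrams in `A` up to planar isotopy. -/
abbrev TangleCat : Type := CategoryTheory.Quotient PlanarMove

/-- Its linearization: morphisms are formal complex linear combinations. -/
abbrev LinTangleCat : Type := Free ℂ TangleCat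

def linOb (n : ℕ) : LinTangleCat := Free.of ℂ ((Quotient.functor PlanarMove).obj (ob n))

/-- The class of a diagram in the linearization. -/
def lin {m n : ℕ} (D : Diagram m n) : linOb m ⟶ linOb n :=
  (Free.embedding ℂ TangleCat).map ((Quotient.functor PlanarMove).map D)

/-- `-(t^{1/2} + t^{-1/2})`, where `q = t^{1/4}`. -/
def loopValue (q : ℂˣ) : ℂ := -((q : ℂ) ^ 2 + ((q⁻¹ : ℂˣ) : ℂ) ^ 2)

/-- The Kauffman skein relation (for both positions of a crossing relative to the radius), the loop
removal relation, and their closure to a linear congruence; `q = t^{1/4}`. -/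
inductive SkeinRel (q : ℂˣ) : HomRel LinTangleCat
  | kauffman_ccwOver (a b : ℕ) {n k : ℕ} (hn : n = a + 2 + b) (hk : k = a + b) :
      SkeinRel q (lin (piece ccwOver a b : Diagram n n))
        ((q : ℂ) • 𝟙 (linOb n) +
          ((q⁻¹ : ℂˣ) : ℂ) • lin ((piece cap a b : Diagram n k) ≫ (piece cup a b : Diagram k n)))
  | kauffman_cwOver (a b : ℕ) {n k : ℕ} (hn : n = a + 2 + b) (hk : k = a + b) :
      SkeinRel q (lin (piece cwOver a b : Diagram n n))
        ((q : ℂ) • lin ((piece cap a b : Diagram n k) ≫ (piece cup a b : Diagram k n)) +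
          ((q⁻¹ : ℂˣ) : ℂ) • 𝟙 (linOb n))
  | loop (a b : ℕ) {n k : ℕ} (hn : n = a + 2 + b) (hk : k = a + b) :
      SkeinRel q (lin ((piece cup a b : Diagram k n) ≫ (piece cap a b : Diagram n k)))
        (loopValue q • 𝟙 (linOb k))
  | refl {X Y : LinTangleCat} (f : X ⟶ Y) : SkeinRel q f f
  | symm {X Y : LinTangleCat} {f g : X ⟶ Y} : SkeinRel q f g → SkeinRel q g f
  | trans {X Y : LinTangleCat} {f g h : X ⟶ Y} :
      SkeinRel q f g → SkeinRel q g h → SkeinRel q f h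
  | add {X Y : LinTangleCat} {f f' g g' : X ⟶ Y} :
      SkeinRel q f f' → SkeinRel q g g' → SkeinRel q (f + g) (f' + g')
  | smul {X Y : LinTangleCat} (c : ℂ) {f g : X ⟶ Y} :
      SkeinRel q f g → SkeinRel q (c • f) (c • g)
  | comp {X Y Z : LinTangleCat} {f f' : X ⟶ Y} {g g' : Y ⟶ Z} :
      SkeinRel q f f' → SkeinRel q g g' → SkeinRel q (f ≫ g) (f' ≫ g')

instance (q : ℂˣ) : Congruence (SkeinRel q) where
  equivalence := ⟨SkeinRel.refl, SkeinRel.symm, SkeinRel.trans⟩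
  comp_left f _ _ h := SkeinRel.comp (SkeinRel.refl f) h
  comp_right g h := SkeinRel.comp h (SkeinRel.refl g)

/-- The skein category of the annulus with parameter `q = t^{1/4}`. -/
abbrev Skein (q : ℂˣ) : Type := CategoryTheory.Quotient (SkeinRel q)

instance (q : ℂˣ) : Preadditive (Skein q) :=
  Quotient.preadditive (SkeinRel q) fun _ _ _ _ _ _ h h' => SkeinRel.add h h'

instance (q : ℂˣ) : (Quotient.functor (SkeinRel q)).Additive :=
  Quotient.functor_additive (SkeinRel q) fun _ _ _ _ _ _ h h' => SkeinRel.add h h'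

instance (q : ℂˣ) : Linear ℂ (Skein q) :=
  Quotient.linear ℂ (SkeinRel q) fun c _ _ _ _ h => SkeinRel.smul c h

instance (q : ℂˣ) : (Quotient.functor (SkeinRel q)).Linear ℂ :=
  Quotient.linear_functor ℂ (SkeinRel q) fun c _ _ _ _ h => SkeinRel.smul c h

/-- The functor sending a diagram to its class in the skein category. -/
def diagFunctor (q : ℂˣ) : Paths Circ ⥤ Skein q :=
  Quotient.functor PlanarMove ⋙ Free.embedding ℂ TangleCat ⋙ Quotient.functor (SkeinRel q)

/-- The object `n` of the skein category. -/
abbrev skOb (q : ℂˣ) (n : ℕ) : Skein q := (diagFunctor q).obj (ob n)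

/-- The class `[D]` of a diagram in the skein category. -/
def sk (q : ℂˣ) {m n : ℕ} (D : Diagram m n) : skOb q m ⟶ skOb q n :=
  (diagFunctor q).map D

lemma sk_eq_lin (q : ℂˣ) {m n : ℕ} (D : Diagram m n) :
   sk q D = (Quotient.functor (SkeinRel q)).map (lin D) := rfl

lemma sk_comp (q : ℂˣ) {k m n : ℕ} (D : Diagram k m) (D' : Diagram m n) :
    sk q (D ≫ D') = sk q D ≫ sk q D' := (diagFunctor q).map_comp D D'

lemma sk_id (q : ℂˣ) (n : ℕ) : sk q (𝟙 (ob n)) = 𝟙 (skOb q n) := (diagFunctor q).map_id _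

lemma sk_move (q : ℂˣ) {m n : ℕ} {D D' : Diagram m n} (h : PlanarMove D D') :
    sk q D = sk q D' := by
  have := CategoryTheory.Quotient.sound _ h
  unfold sk diagFunctor
  simp only [Functor.comp_map]
  rw [this]

lemma sk_ccwOver (q : ℂˣ) (a b : ℕ) {n k : ℕ} (hn : n = a + 2 + b) (hk : k = a + b) :
    sk q (piece ccwOver a b : Diagram n n) = (q : ℂ) • 𝟙 (skOb q n) +
      ((q⁻¹ : ℂˣ) : ℂ) • (sk q (piece cap a b : Diagram n k) ≫ sk q (piece cup a b : Diagram k n)) := by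
  have h := CategoryTheory.Quotient.sound _ (SkeinRel.kauffman_ccwOver (q := q) a b hn hk)
  rw [Functor.map_add, Functor.map_smul, Functor.map_smul, CategoryTheory.Functor.map_id] at h
  rw [← sk_comp]
  exact h

lemma sk_cwOver (q : ℂˣ) (a b : ℕ) {n k : ℕ} (hn : n = a + 2 + b) (hk : k = a + b) :
    sk q (piece cwOver a b : Diagram n n) =
      (q : ℂ) • (sk q (piece cap a b : Diagram n k) ≫ sk q (piece cup a b : Diagram k n)) +
       ((q⁻¹ : ℂˣ) : ℂ) •  𝟙 (skOb q n) := by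
  have h := CategoryTheory.Quotient.sound _ (SkeinRel.kauffman_cwOver (q := q) a b hn hk)
  rw [Functor.map_add, Functor.map_smul, Functor.map_smul, CategoryTheory.Functor.map_id] at h
  rw [← sk_comp]
  exact h

lemma sk_loop (q : ℂˣ) (a b : ℕ) {n k : ℕ} (hn : n = a + 2 + b) (hk : k = a + b) :
    sk q (piece cup a b : Diagram k n) ≫ sk q (piece cap a b : Diagram n k) =
      loopValue q • 𝟙 (skOb q k) := by
  have h := CategoryTheory.Quotient.sound _ (SkeinRel.loop (q := q) a b hn hk)
  rw [Functor.map_smul, CategoryTheory.Functor.map_id] at h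
  rw [← sk_comp]
  exact h

/-- Arc insertion on one event: the new arc runs radially just before the seam, so it is always at the
last position. A strand that crosses the seam also crosses the new arc, and passes over it. -/
def insertEvent : ∀ {m n : ℕ}, Event m n → Diagram (m + 1) (n + 1)
  | _, _, .piece g a b hm hn => piece g a (b + 1) (by omega) (by omega)
  | n, _, .seamCcw hn => piece ccwOver (n - 1) 0 ≫ seamCcw (Nat.succ_pos n)
  | n, _, .seamCw hn => seamCw (Nat.succ_pos n) ≫ piece cwOver (n - 1) 0

/-- Insertion of an arc into diagrams, underneath everything it meets. -/
def insertArc : Paths Circ ⥤ Paths Circ :=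
  Paths.lift
    { obj := fun X => ob (X.pts + 1)
      map := fun e => insertEvent e }

/-- The diagram obtained from `D` by inserting the arc. -/
def ins {m n : ℕ} (D : Diagram m n) : Diagram (m + 1) (n + 1) := insertArc.map D

lemma ins_comp {k m n : ℕ} (D : Diagram k m) (D' : Diagram m n) :
    ins (D ≫ D') = ins D ≫ ins D' := insertArc.map_comp D D'

lemma ins_id (n : ℕ) : ins (𝟙 (ob n)) = 𝟙 (ob (n + 1)) := rfl

lemma ins_piece (g : LocalPiece) (a b : ℕ) {m n : ℕ}
    (hm : m = a + g.dom + b) (hn : n = a + g.cod + b) :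
    ins (piece g a b hm hn) = (piece g a (b + 1) (by omega) (by omega) : Diagram (m + 1) (n + 1)) :=
  Paths.lift_toPath _ _
lemma ins_seamCcw {n : ℕ} (hn : 0 < n) :
    ins (seamCcw hn) = (piece ccwOver (n - 1) 0 : Diagram (n+1) (n+1)) ≫ seamCcw (Nat.succ_pos n) :=
  Paths.lift_toPath _ _
lemma ins_seamCw {n : ℕ} (hn : 0 < n) :
    ins (seamCw hn) = seamCw (Nat.succ_pos n) ≫ (piece cwOver (n - 1) 0 : Diagram (n+1) (n+1))  :=
  Paths.lift_toPath _ _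


section WellDefined

variable (q : ℂˣ)

lemma sk_interchange (f g : LocalPiece) (a c b : ℕ) {r p r' p' m k l n : ℕ}
    (hr : r = c + g.dom + b) (hp : p = a + f.cod + c)
    (hr' : r' = c + g.cod + b) (hp' : p' = a + f.dom + c)
    (h1 : m = a + f.dom + r) (h2 : k = a + f.cod + r)
    (h3 : k = p + g.dom + b) (h4 : n = p + g.cod + b)
    (h5 : m = p' + g.dom + b) (h6 : l = p' + g.cod + b)
    (h7 : l = a + f.dom + r') (h8 : n = a + f.cod + r') :
    sk q (piece f a r h1 h2) ≫ sk q (piece g p b h3 h4) =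
      sk q (piece g p' b h5 h6) ≫ sk q (piece f a r' h7 h8) := by
  subst hr hp hr' hp'
  rw [← sk_comp, ← sk_comp]
  exact sk_move q (PlanarMove.interchange f g a c b (by omega) (by omega) (by omega) (by omega))

lemma sk_ccw_cw (a b : ℕ) {n : ℕ} (hn : n = a + 2 + b) :
    sk q (piece ccwOver a b : Diagram n n) ≫ sk q (piece cwOver a b : Diagram n n) =
      𝟙 (skOb q n) := by
  rw [sk_ccwOver q a b hn rfl, sk_cwOver q a b hn rfl]
  have h := sk_loop q a b hn rfl
  have hq : (q : ℂ) ≠ 0 := q.ne_zero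
  simp only [Preadditive.add_comp, Preadditive.comp_add, Linear.smul_comp, Linear.comp_smul,
    Category.id_comp, Category.comp_id, Category.assoc, smul_add, smul_smul]
  rw [← Category.assoc (sk q (piece cup a b : Diagram (a + b) n)), h]
  simp only [Linear.smul_comp, Linear.comp_smul, Category.id_comp, smul_smul, loopValue]
  match_scalars <;> simp <;> field_simp <;> ring

lemma sk_cw_ccw (a b : ℕ) {n : ℕ} (hn : n = a + 2 + b) :
    sk q (piece cwOver a b : Diagram n n) ≫ sk q (piece ccwOver a b : Diagram n n) =
      𝟙 (skOb q n) := by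
  rw [sk_ccwOver q a b hn rfl, sk_cwOver q a b hn rfl]
  have h := sk_loop q a b hn rfl
  have hq : (q : ℂ) ≠ 0 := q.ne_zero
  simp only [Preadditive.add_comp, Preadditive.comp_add, Linear.smul_comp, Linear.comp_smul,
    Category.id_comp, Category.comp_id, Category.assoc, smul_add, smul_smul]
  rw [← Category.assoc (sk q (piece cup a b : Diagram (a + b) n)), h]
  simp only [Linear.smul_comp, Linear.comp_smul, Category.id_comp, smul_smul, loopValue]
  match_scalars <;> simp <;> field_simp <;> ring

lemma sk_seam_inv {n : ℕ} (hn : 0 < n) :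
    sk q (seamCcw hn) ≫ sk q (seamCw hn) = 𝟙 (skOb q n) := by
  rw [← sk_comp, sk_move q (PlanarMove.seamCcw_seamCw hn), sk_id]

lemma sk_inv_seam {n : ℕ} (hn : 0 < n) :
    sk q (seamCw hn) ≫ sk q (seamCcw hn) = 𝟙 (skOb q n) := by
  rw [← sk_comp, sk_move q (PlanarMove.seamCw_seamCcw hn), sk_id]

lemma sk_seam_piece (g : LocalPiece) (a b : ℕ) {m n : ℕ}
      (hm : m = a + g.dom + b + 1) (hn : n = a + g.cod + b + 1) :
    sk q (piece g a (b + 1) (by omega) (by omega) : Diagram m n) ≫ sk q (seamCcw (by omega)) =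
      sk q (seamCcw (by omega)) ≫ sk q (piece g (a + 1) b (by omega) (by omega) : Diagram m n) := by
  rw [← sk_comp, ← sk_comp]
  exact sk_move q (PlanarMove.seam_piece g a b hm hn)

lemma sk_pull_cup (a b : ℕ) {m n : ℕ} (hm : m = a + 1 + b) (hn : n = a + 3 + b) :
    sk q (piece cup a (b + 1) : Diagram m n) ≫ sk q (piece ccwOver (a + 1) b : Diagram n n) ≫
      sk q (piece ccwOver a (b + 1) : Diagram n n) = sk q (piece cup (a + 1) b : Diagram m n) := by
  rw [← Category.assoc, ← sk_comp, sk_move q (PlanarMove.cup_ccwOver a b hm hn), sk_comp,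
    Category.assoc, sk_cw_ccw q a (b + 1) (by omega), Category.comp_id]

lemma sk_pull_cap (a b : ℕ) {m n : ℕ} (hm : m = a + 3 + b) (hn : n = a + 1 + b) :
    sk q (piece ccwOver (a + 1) b : Diagram m m) ≫ sk q (piece ccwOver a (b + 1) : Diagram m m) ≫
      sk q (piece cap (a + 1) b : Diagram m n) = sk q (piece cap a (b + 1) : Diagram m n) := by
  rw [← sk_comp q (piece ccwOver a (b + 1) : Diagram m m),
    ← sk_move q (PlanarMove.cap_cwOver a b hm hn), sk_comp,
    ← Category.assoc, sk_ccw_cw q (a + 1) b (by omega), Category.id_comp]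

lemma sk_pull_ccw (a b : ℕ) {n : ℕ} (hn : n = a + 3 + b) :
    sk q (piece ccwOver a (b + 1) : Diagram n n) ≫ sk q (piece ccwOver (a + 1) b : Diagram n n) ≫
      sk q (piece ccwOver a (b + 1) : Diagram n n) =
    sk q (piece ccwOver (a + 1) b : Diagram n n) ≫ sk q (piece ccwOver a (b + 1) : Diagram n n) ≫
      sk q (piece ccwOver (a + 1) b : Diagram n n) := by
  have h1 := sk_pull_cup q a b (m := a + 1 + b) rfl hn
  have h2 := sk_pull_cap q a b hn (n := a + 1 + b) rfl
  have e1 := sk_ccwOver q a (b + 1) (n := n) (k := a + 1 + b) (by omega) (by omega)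
  have e2 := sk_ccwOver q (a + 1) b (n := n) (k := a + 1 + b) (by omega) (by omega)
  set A := sk q (piece ccwOver a (b + 1) : Diagram n n)
  set B := sk q (piece ccwOver (a + 1) b : Diagram n n)
  have : A ≫ B ≫ A = ((q : ℂ) • 𝟙 (skOb q n) + ((q⁻¹ : ℂˣ) : ℂ) •
    (sk q (piece cap a (b + 1) : Diagram n (a + 1 + b)) ≫ sk q (piece cup a (b + 1) : Diagram (a + 1 + b) n))) ≫ B ≫ A := by rw [← e1]
  rw [this]
  have : B ≫ A ≫ B = B ≫ A ≫ ((q : ℂ) • 𝟙 (skOb q n) + ((q⁻¹ : ℂˣ) : ℂ) •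
    (sk q (piece cap (a + 1) b : Diagram n (a + 1 + b)) ≫ sk q (piece cup (a + 1) b : Diagram (a + 1 + b) n))) := by rw [← e2]
  rw [this]
  simp only [Preadditive.add_comp, Preadditive.comp_add, Linear.smul_comp, Linear.comp_smul,
    Category.id_comp, Category.comp_id, Category.assoc, h1]
  rw [← Category.assoc A, ← Category.assoc B, h2]

lemma sk_pull_cw (a b : ℕ) {n : ℕ} (hn : n = a + 3 + b) :
    sk q (piece cwOver a (b + 1) : Diagram n n) ≫ sk q (piece ccwOver (a + 1) b : Diagram n n) ≫
      sk q (piece ccwOver a (b + 1) : Diagram n n) =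
    sk q (piece ccwOver (a + 1) b : Diagram n n) ≫ sk q (piece ccwOver a (b + 1) : Diagram n n) ≫
      sk q (piece cwOver (a + 1) b : Diagram n n) := by
  have h1 := sk_pull_cup q a b (m := a + 1 + b) rfl hn
  have h2 := sk_pull_cap q a b hn (n := a + 1 + b) rfl
  rw [sk_cwOver q a (b + 1) (n := n) (k := a + 1 + b) (by omega) (by omega),
    sk_cwOver q (a + 1) b (n := n) (k := a + 1 + b) (by omega) (by omega)]
  simp only [Preadditive.add_comp, Preadditive.comp_add, Linear.smul_comp, Linear.comp_smul,
    Category.id_comp, Category.comp_id, Category.assoc, h1]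
  rw [← Category.assoc (sk q (piece ccwOver a (b + 1) : Diagram n n)),
    ← Category.assoc (sk q (piece ccwOver (a + 1) b : Diagram n n)), h2]

lemma sk_ins_seam_seam (a : ℕ) {n : ℕ} (hn : n = a + 2) (hn' : 0 < n) :
    sk q (ins (seamCcw hn')) ≫ sk q (ins (seamCcw hn')) =
      sk q (piece ccwOver (a + 1) 0 : Diagram (n + 1) (n + 1)) ≫
      sk q (piece ccwOver a 1 : Diagram (n + 1) (n + 1)) ≫
      sk q (seamCcw (Nat.succ_pos n)) ≫ sk q (seamCcw (Nat.succ_pos n)) := by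
  subst hn
  have h := sk_seam_piece q ccwOver a 0 (m := a + 2 + 1) (n := a + 2 + 1) rfl rfl
  rw [ins_seamCcw, sk_comp]
  simp only [Category.assoc]
  have h' := h =≫ sk q (seamCcw (Nat.succ_pos (a + 2)))
  simp only [Category.assoc] at h'
  exact congrArg (_ ≫ ·) h'.symm

theorem sk_ins_move {m n : ℕ} {D D' : Diagram m n} (h : PlanarMove D D') :
    sk q (ins D) = sk q (ins D') := by
  cases h with
  | interchange f g a c b hm hk hl hn =>
    simp only [ins_comp, ins_piece, sk_comp]
    exact sk_interchange q f g a c (b + 1) (by omega) rfl (by omega) rfl _ _ _ _ _ _ _ _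
  | zigzag_left a b hm hk =>
    simp only [ins_comp, ins_piece, ins_id]
    exact sk_move q (PlanarMove.zigzag_left a (b + 1) (by omega) (by omega))
  | zigzag_right a b hm hk =>
    simp only [ins_comp, ins_piece, ins_id]
    exact sk_move q (PlanarMove.zigzag_right a (b + 1) (by omega) (by omega))
  | cap_ccwOver a b hm hk =>
    simp only [ins_comp, ins_piece]
    exact sk_move q (PlanarMove.cap_ccwOver a (b + 1) (by omega) (by omega))
  | cap_cwOver a b hm hk =>
    simp only [ins_comp, ins_piece]
    exact sk_move q (PlanarMove.cap_cwOver a (b + 1) (by omega) (by omega))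
  | cup_ccwOver a b hm hk =>
    simp only [ins_comp, ins_piece]
    exact sk_move q (PlanarMove.cup_ccwOver a (b + 1) (by omega) (by omega))
  | cup_cwOver a b hm hk =>
    simp only [ins_comp, ins_piece]
    exact sk_move q (PlanarMove.cup_cwOver a (b + 1) (by omega) (by omega))
  | seamCcw_seamCw hn =>
    simp only [ins_comp, ins_seamCcw, ins_seamCw, sk_comp, ins_id, sk_id, Category.assoc]
    rw [← Category.assoc (sk q (seamCcw _)), sk_seam_inv, Category.id_comp,
      sk_ccw_cw q _ _ (by omega)]
  | seamCw_seamCcw hn =>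
    simp only [ins_comp, ins_seamCcw, ins_seamCw, sk_comp, ins_id, sk_id, Category.assoc]
    rw [← Category.assoc (sk q (piece cwOver _ _ _ _)), sk_cw_ccw q _ _ (by omega),
      Category.id_comp, sk_inv_seam]
  | seam_piece g a b hm hn =>
    simp only [ins_comp, ins_seamCcw, ins_piece, sk_comp, Category.assoc]
    rw [← sk_seam_piece q g a (b + 1) (by omega) (by omega), ← Category.assoc,
      ← Category.assoc]
    congr 1
    exact sk_interchange q g ccwOver a b 0 rfl (by omega) rfl (by omega)
      _ _ _ _ _ _ _ _
  | seam_cup _ hn =>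
    have h1 := sk_move q (PlanarMove.seam_cup (m + 1) (n := n + 1) (by omega))
    have h2 := sk_pull_cup q m 0 (m := m + 1) (n := n + 1) (by omega) (by omega)
    simp only [sk_comp] at h1
    rw [ins_comp, sk_comp, ins_comp, sk_comp, sk_ins_seam_seam q m hn, ins_piece, ins_piece,
      ← h1, ← h2]
    simp only [Category.assoc]
  | seam_cap _ hn =>
    have h1 := sk_move q (PlanarMove.seam_cap (n + 1) (n := m + 1) (by omega))
    have h2 := sk_pull_cap q n 0 (m := m + 1) (n := n + 1) (by omega) (by omega)
    simp only [sk_comp] at h1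
    rw [ins_comp, sk_comp, ins_comp, sk_comp, ← Category.assoc, sk_ins_seam_seam q n hn,
      ins_piece, ins_piece]
    simp only [Category.assoc, h1]
    exact h2
  | seam_ccwOver a hn =>
    have h1 := sk_move q (PlanarMove.seam_ccwOver (a + 1) (n := m + 1) (by omega))
    have h2 := sk_pull_ccw q a 0 (n := m + 1) (by omega)
    simp only [sk_comp] at h1
    simp only [ins_comp, sk_comp]
    rw [← Category.assoc (sk q (ins (seamCcw _))), sk_ins_seam_seam q a hn, ins_piece, ins_piece]
    simp only [Category.assoc, ← h1]
    have h3 := h2 =≫ (sk q (seamCcw (Nat.succ_pos m)) ≫ sk q (seamCcw (Nat.succ_pos m)))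
    simp only [Category.assoc] at h3
    exact h3
  | seam_cwOver a hn =>
    have h1 := sk_move q (PlanarMove.seam_cwOver (a + 1) (n := m + 1) (by omega))
    have h2 := sk_pull_cw q a 0 (n := m + 1) (by omega)
    simp only [sk_comp] at h1
    simp only [ins_comp, sk_comp]
    rw [← Category.assoc (sk q (ins (seamCcw _))), sk_ins_seam_seam q a hn, ins_piece, ins_piece]
    simp only [Category.assoc, ← h1]
    have h3 := h2 =≫ (sk q (seamCcw (Nat.succ_pos m)) ≫ sk q (seamCcw (Nat.succ_pos m)))
    simp only [Category.assoc] at h3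
    exact h3

/-- Arc insertion on planar isotopy classes. -/
def insTangle : TangleCat ⥤ Skein q :=
  CategoryTheory.Quotient.lift PlanarMove (insertArc ⋙ diagFunctor q) fun _ _ _ _ h => sk_ins_move q h

/-- Linear extension of arc insertion. -/
def insLin : LinTangleCat ⥤ Skein q := Free.lift ℂ (insTangle q)

instance : (insLin q).Additive := inferInstanceAs (Free.lift ℂ (insTangle q)).Additive
instance : (insLin q).Linear ℂ := inferInstanceAs ((Free.lift ℂ (insTangle q)).Linear ℂ)

lemma insLin_lin {m n : ℕ} (D : Diagram m n) : (insLin q).map (lin D) = sk q (ins D) := by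
  have := Free.lift_map_single ℂ (insTangle q) ((Quotient.functor PlanarMove).map D) 1
  rw [one_smul] at this
  exact this

theorem insLin_rel {X Y : LinTangleCat} {f g : X ⟶ Y} (h : SkeinRel q f g) :
    (insLin q).map f = (insLin q).map g := by
  induction h with
  | kauffman_ccwOver a b hn hk =>
    rw [Functor.map_add, Functor.map_smul, Functor.map_smul, CategoryTheory.Functor.map_id]
    simp only [insLin_lin, ins_comp, ins_piece, sk_comp]
    exact sk_ccwOver q a (b + 1) (by omega) (by omega)
  | kauffman_cwOver a b hn hk =>
    rw [Functor.map_add, Functor.map_smul, Functor.map_smul, CategoryTheory.Functor.map_id]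
    simp only [insLin_lin, ins_comp, ins_piece, sk_comp]
    exact sk_cwOver q a (b + 1) (by omega) (by omega)
  | loop a b hn hk =>
    rw [Functor.map_smul, CategoryTheory.Functor.map_id]
    simp only [insLin_lin, ins_comp, ins_piece, sk_comp]
    exact sk_loop q a (b + 1) (by omega) (by omega)
  | refl f => rfl
  | symm _ ih => exact ih.symm
  | trans _ _ ih ih' => exact ih.trans ih'
  | add _ _ ih ih' => rw [Functor.map_add, Functor.map_add, ih, ih']
  | smul c _ ih => rw [Functor.map_smul, Functor.map_smul, ih]
  | comp _ _ ih ih' => rw [Functor.map_comp, Functor.map_comp, ih, ih']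

/-- The arc insertion functor of the skein category. -/
def arcInsertion : Skein q ⥤ Skein q :=
  CategoryTheory.Quotient.lift (SkeinRel q) (insLin q) fun _ _ _ _ h => insLin_rel q h

instance : (arcInsertion q).Additive where
  map_add {X Y f g} := by
    obtain ⟨f, rfl⟩ := (Quotient.functor (SkeinRel q)).map_surjective f
    obtain ⟨g, rfl⟩ := (Quotient.functor (SkeinRel q)).map_surjective g
    exact (insLin q).map_add

instance : (arcInsertion q).Linear ℂ where
  map_smul {X Y} f c := by
    obtain ⟨f, rfl⟩ := (Quotient.functor (SkeinRel q)).map_surjective f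
    have h1 := CategoryTheory.Quotient.lift_map_functor_map (SkeinRel q) (insLin q)
      (fun _ _ _ _ h => insLin_rel q h) (c • f)
    rw [Functor.map_smul (Quotient.functor (SkeinRel q)), Functor.map_smul (insLin q)] at h1
    exact h1

theorem arcInsertion_obj (n : ℕ) : (arcInsertion q).obj (skOb q n) = skOb q (n + 1) := rfl

theorem arcInsertion_sk {m n : ℕ} (D : Diagram m n) :
    (arcInsertion q).map (sk q D) = sk q (ins D) := insLin_lin q D

/-- The algebra `End_S(n)`; in the product `f * g` the diagram of `g` is placed inside. -/
abbrev EndS (n : ℕ) : Type := End (skOb q n)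

/-- The algebra map `End_S(n) → End_S(n + 1)` given by arc insertion. -/
def arcInsertionHom (n : ℕ) : EndS q n →ₐ[ℂ] EndS q (n + 1) :=
  AlgHom.ofLinearMap ((arcInsertion q).mapLinearMap ℂ)
    ((arcInsertion q).map_id (skOb q n)) (fun f g => (arcInsertion q).map_comp g f)

end WellDefined

section TL
open scoped Polynomial LaurentPolynomial

/-- Generators of the extended affine Temperley-Lieb algebra, `n ≥ 2`; indices modulo `n`. -/
inductive TLGen (n : ℕ) : Type
  | e (i : ZMod n)
  | rho
  | rhoInv

/-- Defining relations of the `n`-th extended affine Temperley-Lieb algebra for `n = 2` and `n ≥ 3`. -/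
inductive TLRel (q : ℂˣ) (n : ℕ) : FreeAlgebra ℂ (TLGen n) → FreeAlgebra ℂ (TLGen n) → Prop
  | e_sq (i : ZMod n) :
      TLRel q n (FreeAlgebra.ι ℂ (.e i) * FreeAlgebra.ι ℂ (.e i))
        (loopValue q • FreeAlgebra.ι ℂ (.e i))
  | e_comm (hn : 3 ≤ n) (i j : ZMod n) (h : i - j ≠ 1) (h' : i - j ≠ -1) :
      TLRel q n (FreeAlgebra.ι ℂ (.e i) * FreeAlgebra.ι ℂ (.e j))
        (FreeAlgebra.ι ℂ (.e j) * FreeAlgebra.ι ℂ (.e i))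
  | e_succ (hn : 3 ≤ n) (i : ZMod n) :
      TLRel q n
        (FreeAlgebra.ι ℂ (.e i) * FreeAlgebra.ι ℂ (.e (i + 1)) * FreeAlgebra.ι ℂ (.e i))
        (FreeAlgebra.ι ℂ (.e i))
  | e_pred (hn : 3 ≤ n) (i : ZMod n) :
      TLRel q n
        (FreeAlgebra.ι ℂ (.e i) * FreeAlgebra.ι ℂ (.e (i - 1)) * FreeAlgebra.ι ℂ (.e i))
        (FreeAlgebra.ι ℂ (.e i))
  | rho_e (i : ZMod n) :
      TLRel q n (FreeAlgebra.ι ℂ .rho * FreeAlgebra.ι ℂ (.e i))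
        (FreeAlgebra.ι ℂ (.e (i + 1)) * FreeAlgebra.ι ℂ .rho)
  | rho_rhoInv : TLRel q n (FreeAlgebra.ι ℂ .rho * FreeAlgebra.ι ℂ .rhoInv) 1
  | rhoInv_rho : TLRel q n (FreeAlgebra.ι ℂ .rhoInv * FreeAlgebra.ι ℂ .rho) 1
  | rho_sq_e (hn : n = 2) :
      TLRel q n (FreeAlgebra.ι ℂ .rho ^ 2 * FreeAlgebra.ι ℂ (.e 1)) (FreeAlgebra.ι ℂ (.e 1))
  | rho_e_pow (hn : 3 ≤ n) :
      TLRel q n ((FreeAlgebra.ι ℂ .rho * FreeAlgebra.ι ℂ (.e 1)) ^ (n - 1))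
        (FreeAlgebra.ι ℂ .rho ^ n * (FreeAlgebra.ι ℂ .rho * FreeAlgebra.ι ℂ (.e 1)))

/-- The extended affine Temperley-Lieb algebras `TL_n`. -/
def TL (q : ℂˣ) : ℕ → Type
  | 0 => ℂ[X]
  | 1 => ℂ[T;T⁻¹]
  | n + 2 => RingQuot (TLRel q (n + 2))

namespace TL
variable (q : ℂˣ)

instance instRing : ∀ n, Ring (TL q n)
  | 0 => inferInstanceAs (Ring ℂ[X])
  | 1 => inferInstanceAs (Ring ℂ[T;T⁻¹])
  | n + 2 => inferInstanceAs (Ring (RingQuot (TLRel q (n + 2))))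

instance instAlgebra : ∀ n, Algebra ℂ (TL q n)
  | 0 => inferInstanceAs (Algebra ℂ ℂ[X])
  | 1 => inferInstanceAs (Algebra ℂ ℂ[T;T⁻¹])
  | n + 2 => inferInstanceAs (Algebra ℂ (RingQuot (TLRel q (n + 2))))

/-- The generator of `TL_0`. -/
def X : TL q 0 := (Polynomial.X : ℂ[X])

/-- The generator `ρ` of `TL_n` for `n ≥ 1` (there is none for `n = 0`). -/
def rho : ∀ n, TL q n
  | 0 => 0
  | 1 => (LaurentPolynomial.T 1 : ℂ[T;T⁻¹])
  | n + 2 => RingQuot.mkAlgHom ℂ (TLRel q (n + 2)) (FreeAlgebra.ι ℂ .rho)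

/-- The inverse of `ρ` in `TL_n` for `n ≥ 1`. -/
def rhoInv : ∀ n, TL q n
  | 0 => 0
  | 1 => (LaurentPolynomial.T (-1) : ℂ[T;T⁻¹])
  | n + 2 => RingQuot.mkAlgHom ℂ (TLRel q (n + 2)) (FreeAlgebra.ι ℂ .rhoInv)

/-- The generators `e_i` of `TL_n` for `n ≥ 2` (there are none for `n < 2`). -/
def e : ∀ n, ZMod n → TL q n
  | 0, _ => 0
  | 1, _ => 0
  | n + 2, i => RingQuot.mkAlgHom ℂ (TLRel q (n + 2)) (FreeAlgebra.ι ℂ (.e i))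

end TL
end TL

section Realization

variable (q : ℂˣ)

/-- A simple closed curve around the hole of the annulus. -/
def loopDiagram : Diagram 0 0 :=
  (piece cup 0 0 : Diagram 0 2) ≫ seamCcw (by omega) ≫ (piece cap 0 0 : Diagram 2 0)

/-- Inner endpoints `a + 1, a + 2` are joined, outer endpoints `a + 1, a + 2` are joined. -/
def capCup (a b : ℕ) {n : ℕ} (hn : n = a + 2 + b) : Diagram n n :=
  (piece cap a b : Diagram n (a + b)) ≫ (piece cup a b : Diagram (a + b) n)

lemma capCup_eq (a b : ℕ) {n k : ℕ} (hn : n = a + 2 + b) (hk : k = a + b) :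
    capCup a b hn = (piece cap a b : Diagram n k) ≫ (piece cup a b : Diagram k n) := by
  subst hk; rfl

/-- The diagram of `e_i` with `n + 2` inner and outer points: positions `i, i + 1` are joined at both
boundaries; for `i = n + 2` (that is, `i = 0`) the two arcs cross the seam. -/
def eDiagram (n : ℕ) (i : ZMod (n + 2)) : Diagram (n + 2) (n + 2) :=
  if h : i.val = 0 then
    seamCw (by omega) ≫ capCup n 0 (by omega) ≫ seamCcw (by omega)
  else capCup (i.val - 1) (n + 1 - i.val) (by have := ZMod.val_lt i; omega)

/-- Class of the diagram of `e_i`. -/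
def clE (n : ℕ) (i : ZMod (n + 2)) : EndS q (n + 2) := sk q (eDiagram n i)
/-- Class of the diagram of `ρ`: inner `j` is joined to outer `j + 1`. -/
def clRho {n : ℕ} (hn : 0 < n) : EndS q n := sk q (seamCcw hn)
/-- Class of the diagram of the inverse of `ρ`. -/
def clRhoInv {n : ℕ} (hn : 0 < n) : EndS q n := sk q (seamCw hn)

lemma clRho_mul_clRhoInv {n : ℕ} (hn : 0 < n) : clRho q hn * clRhoInv q hn = 1 :=
  sk_inv_seam q hn

lemma clRhoInv_mul_clRho {n : ℕ} (hn : 0 < n) : clRhoInv q hn * clRho q hn = 1 :=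
  sk_seam_inv q hn

lemma eDiagram_zero (n : ℕ) (i : ZMod (n + 2)) (h : i.val = 0) : eDiagram n i =
    seamCw (by omega) ≫ capCup n 0 (by omega) ≫ seamCcw (by omega) := dif_pos h

lemma eDiagram_pos (n a b : ℕ) (i : ZMod (n + 2)) (h : i.val = a + 1) (hb : n = a + b) :
    eDiagram n i = capCup a b (by omega) := by
  have h0 : ¬ i.val = 0 := by omega
  rw [eDiagram, dif_neg h0]
  have h1 : i.val - 1 = a := by omega
  have h2 : n + 1 - i.val = b := by omega
  congr 1

lemma sk_capCup_seam (a b : ℕ) {n : ℕ} (hn : n = a + b + 3) :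
    sk q (capCup a (b + 1) (by omega) : Diagram n n) ≫ sk q (seamCcw (by omega)) =
      sk q (seamCcw (by omega)) ≫ sk q (capCup (a + 1) b (by omega) : Diagram n n) := by
  have h1 := sk_seam_piece q cup a b (m := a + (b + 1)) (n := n) (by simp <;> omega) (by simp <;> omega)
  have h2 := sk_seam_piece q cap a b (m := n) (n := a + (b + 1)) (by simp <;> omega) (by simp <;> omega)
  have e := capCup_eq (a + 1) b (n := n) (k := a + (b + 1)) (by omega) (by omega)
  rw [e, capCup, sk_comp, sk_comp, Category.assoc, h1, ← Category.assoc, h2, Category.assoc]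

lemma sk_capCup_seam_seam (a : ℕ) {n : ℕ} (hn : n = a + 2) (hn' : 0 < n) :
    sk q (capCup a 0 (by omega) : Diagram n n) ≫ sk q (seamCcw hn') ≫ sk q (seamCcw hn') =
      sk q (seamCcw hn') ≫ sk q (seamCcw hn') ≫ sk q (capCup 0 a (by omega) : Diagram n n) := by
  have h1 := sk_move q (PlanarMove.seam_cup a hn)
  have h2 := sk_move q (PlanarMove.seam_cap a hn)
  simp only [sk_comp] at h1 h2
  have e := capCup_eq 0 a (n := n) (k := a) (by omega) (by omega)
  have h3 := h2 =≫ (sk q (piece cup a 0 : Diagram a n) ≫ sk q (seamCcw hn') ≫ sk q (seamCcw hn'))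
  simp only [Category.assoc] at h3
  rw [e, sk_comp, ← h1, h3, capCup, sk_comp]
  simp only [Category.assoc]

lemma zmod_val_one (n : ℕ) : (1 : ZMod (n + 2)).val = 1 := by
  have h := ZMod.val_natCast_of_lt (n := n + 2) (a := 1) (by omega)
  rwa [Nat.cast_one] at h

lemma zmod_val_succ {n : ℕ} (i : ZMod (n + 2)) :
    (i + 1).val = if i.val = n + 1 then 0 else i.val + 1 := by
  have h := ZMod.val_add i 1
  have h1 : (1 : ZMod (n + 2)).val = 1 := zmod_val_one n
  have hl := ZMod.val_lt i
  rw [h, h1]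
  split_ifs with hi
  · rw [hi]; exact Nat.mod_self _
  · exact Nat.mod_eq_of_lt (by omega)

lemma clRho_mul_clE (n : ℕ) (i : ZMod (n + 2)) :
    clRho q (Nat.succ_pos (n + 1)) * clE q n i = clE q n (i + 1) * clRho q (Nat.succ_pos (n + 1)) := by
  change sk q (eDiagram n i) ≫ sk q (seamCcw _) = sk q (seamCcw _) ≫ sk q (eDiagram n (i + 1))
  have hv := zmod_val_succ i
  have hl := ZMod.val_lt i
  rcases Nat.eq_zero_or_pos i.val with h0 | h0
  · rw [if_neg (by omega)] at hv
    rw [eDiagram_zero n i h0, eDiagram_pos n 0 n (i + 1) (by omega) (by omega), sk_comp, sk_comp]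
    simp only [Category.assoc]
    rw [sk_capCup_seam_seam q n rfl, ← Category.assoc, sk_inv_seam, Category.id_comp]
  · by_cases h1 : i.val = n + 1
    · rw [if_pos h1] at hv
      rw [eDiagram_zero n (i + 1) hv, eDiagram_pos n n 0 i (by omega) (by omega), sk_comp, sk_comp,
        ← Category.assoc, sk_seam_inv, Category.id_comp]
    · rw [if_neg h1] at hv
      rw [eDiagram_pos n (i.val - 1) (n - i.val + 1) i (by omega) (by omega),
        eDiagram_pos n (i.val - 1 + 1) (n - i.val) (i + 1) (by omega) (by omega)]
      exact sk_capCup_seam q _ _ (by omega)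

lemma clE_succ (n : ℕ) (i : ZMod (n + 2)) :
    clE q n (i + 1) = clRho q (Nat.succ_pos (n + 1)) * clE q n i *
      clRhoInv q (Nat.succ_pos (n + 1)) := by
  rw [clRho_mul_clE, mul_assoc, clRho_mul_clRhoInv, mul_one]

lemma zmod_induction {n : ℕ} {P : ZMod (n + 2) → Prop} (i₀ : ZMod (n + 2)) (h0 : P i₀)
    (h : ∀ i, P i → P (i + 1)) (i : ZMod (n + 2)) : P i := by
  have : ∀ k : ℕ, P (i₀ + k) := by
    intro k
    induction k with
    | zero => simpa using h0
    | succ k ih => rw [Nat.cast_succ, ← add_assoc]; exact h _ ih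
  have h2 := this (i - i₀).val
  rwa [ZMod.natCast_zmod_val, add_sub_cancel] at h2

lemma conj_mul {n : ℕ} (hn : 0 < n) (x y : EndS q n) :
    (clRho q hn * x * clRhoInv q hn) * (clRho q hn * y * clRhoInv q hn) =
      clRho q hn * (x * y) * clRhoInv q hn := by
  calc _ = clRho q hn * x * (clRhoInv q hn * clRho q hn) * y * clRhoInv q hn := by
        simp only [mul_assoc]
    _ = _ := by rw [clRhoInv_mul_clRho, mul_one]; simp only [mul_assoc]

lemma clE_one (n : ℕ) : clE q n 1 = sk q (capCup 0 n (by omega)) := by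
  rw [clE, eDiagram_pos n 0 n 1 (zmod_val_one n) (by omega)]

lemma zmod_val_two (n : ℕ) : (2 : ZMod (n + 1 + 2)).val = 2 := by
  exact ZMod.val_natCast_of_lt (n := n + 1 + 2) (a := 2) (by omega)

lemma clE_two (n : ℕ) : clE q (n + 1) 2 = sk q (capCup 1 n (by omega)) := by
  rw [clE, eDiagram_pos (n + 1) 1 n 2 (zmod_val_two n) (by omega)]

lemma clE_sq (n : ℕ) (i : ZMod (n + 2)) : clE q n i * clE q n i = loopValue q • clE q n i := by
  refine zmod_induction (P := fun i => clE q n i * clE q n i = loopValue q • clE q n i) 1 ?_ ?_ i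
  · rw [clE_one]
    change sk q (capCup 0 n _) ≫ sk q (capCup 0 n _) = _ • sk q (capCup 0 n _)
    rw [capCup, sk_comp, Category.assoc, ← Category.assoc (sk q (piece cup _ _ _ _)),
      sk_loop q 0 n (by omega) rfl, Linear.smul_comp, Linear.comp_smul, Category.id_comp]
  · intro i h
    rw [clE_succ, conj_mul, h, mul_smul_comm, smul_mul_assoc]

lemma clE_braid_one (n : ℕ) : clE q (n + 1) 1 * clE q (n + 1) 2 * clE q (n + 1) 1 = clE q (n + 1) 1 := by
  rw [clE_one, clE_two]
  change sk q (capCup 0 (n + 1) _) ≫ sk q (capCup 1 n _) ≫ sk q (capCup 0 (n + 1) _) = sk q (capCup 0 (n + 1) _)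
  have h1 := sk_move q (PlanarMove.zigzag_right 0 n (m := 0 + (n + 1)) (k := n + 3) (by omega) (by omega))
  have h2 := sk_move q (PlanarMove.zigzag_left 0 n (m := 0 + (n + 1)) (k := n + 3) (by omega) (by omega))
  have e := capCup_eq 1 n (n := n + 3) (k := 0 + (n + 1)) (by omega) (by omega)
  rw [sk_comp, sk_id] at h1 h2
  rw [e, capCup, sk_comp, sk_comp]
  simp only [Category.assoc]
  have h1' := h1 =≫ (sk q (piece cup 1 n : Diagram (0 + (n + 1)) (n + 3)) ≫
    sk q (piece cap 0 (n + 1) : Diagram (n + 3) (0 + (n + 1))) ≫ sk q (piece cup 0 (n + 1) : Diagram (0 + (n + 1)) (n + 3)))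
  have h2' := h2 =≫ sk q (piece cup 0 (n + 1) : Diagram (0 + (n + 1)) (n + 3))
  simp only [Category.assoc, Category.id_comp] at h1' h2'
  exact congrArg (_ ≫ ·) (h1'.trans h2')

lemma clE_braid_two (n : ℕ) : clE q (n + 1) 2 * clE q (n + 1) 1 * clE q (n + 1) 2 = clE q (n + 1) 2 := by
  rw [clE_one, clE_two]
  change sk q (capCup 1 n _) ≫ sk q (capCup 0 (n + 1) _) ≫ sk q (capCup 1 n _) = sk q (capCup 1 n _)
  have h1 := sk_move q (PlanarMove.zigzag_right 0 n (m := 0 + (n + 1)) (k := n + 3) (by omega) (by omega))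
  have h2 := sk_move q (PlanarMove.zigzag_left 0 n (m := 0 + (n + 1)) (k := n + 3) (by omega) (by omega))
  have e := capCup_eq 1 n (n := n + 3) (k := 0 + (n + 1)) (by omega) (by omega)
  rw [sk_comp, sk_id] at h1 h2
  rw [e, capCup, sk_comp, sk_comp]
  simp only [Category.assoc]
  have h2' := h2 =≫ (sk q (piece cup 0 (n + 1) : Diagram (0 + (n + 1)) (n + 3)) ≫
    sk q (piece cap 1 n : Diagram (n + 3) (0 + (n + 1))) ≫ sk q (piece cup 1 n : Diagram (0 + (n + 1)) (n + 3)))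
  have h1' := h1 =≫ sk q (piece cup 1 n : Diagram (0 + (n + 1)) (n + 3))
  simp only [Category.assoc, Category.id_comp] at h1' h2'
  exact congrArg (_ ≫ ·) (h2'.trans h1')

lemma clE_braid_succ (n : ℕ) (hn : 3 ≤ n + 2) (i : ZMod (n + 2)) :
    clE q n i * clE q n (i + 1) * clE q n i = clE q n i := by
  obtain ⟨n, rfl⟩ : ∃ k, n = k + 1 := ⟨n - 1, by omega⟩
  refine zmod_induction (P := fun i => clE q (n + 1) i * clE q (n + 1) (i + 1) * clE q (n + 1) i = clE q (n + 1) i) 1 ?_ ?_ i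
  · have h := clE_braid_one q n
    have h2 : (2 : ZMod (n + 1 + 2)) = 1 + 1 := by ring
    simp only [h2] at h
    exact h
  · intro i h
    rw [clE_succ q _ (i + 1)]
    nth_rewrite 1 [clE_succ q _ i]
    nth_rewrite 2 [clE_succ q _ i]
    rw [conj_mul, conj_mul, h, ← clE_succ q _ i]

lemma clE_braid_pred (n : ℕ) (hn : 3 ≤ n + 2) (i : ZMod (n + 2)) :
    clE q n i * clE q n (i - 1) * clE q n i = clE q n i := by
  obtain ⟨n, rfl⟩ : ∃ k, n = k + 1 := ⟨n - 1, by omega⟩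
  refine zmod_induction (P := fun i => clE q (n + 1) i * clE q (n + 1) (i - 1) * clE q (n + 1) i = clE q (n + 1) i) 2 ?_ ?_ i
  · have h := clE_braid_two q n
    have h2 : (2 - 1 : ZMod (n + 1 + 2)) = 1 := by ring
    rwa [h2]
  · intro i h
    have e : clE q (n + 1) (i + 1 - 1) = clRho q (Nat.succ_pos _) * clE q (n + 1) (i - 1) *
        clRhoInv q (Nat.succ_pos _) := by
      rw [← clE_succ, add_sub_cancel_right, sub_add_cancel]
    rw [e, clE_succ q _ i, conj_mul, conj_mul, h]

lemma clE_comm (n : ℕ) (hn : 3 ≤ n + 2) (i j : ZMod (n + 2)) (h : i - j ≠ 1) (h' : i - j ≠ -1) :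
    clE q n i * clE q n j = clE q n j * clE q n i := by
  suffices H : ∀ d : ZMod (n + 2), d ≠ 1 → d ≠ -1 → ∀ i,
      clE q n i * clE q n (i - d) = clE q n (i - d) * clE q n i by
    have := H (i - j) h h' i
    rwa [sub_sub_cancel] at this
  clear h h' i j
  intro d h h' i
  refine zmod_induction (P := fun i => clE q n i * clE q n (i - d) = clE q n (i - d) * clE q n i) 1 ?_ ?_ i
  · obtain ⟨k, hk⟩ : ∃ k, k = (1 - d).val := ⟨_, rfl⟩
    have hl := ZMod.val_lt (1 - d)
    have hk0 : k ≠ 0 := by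
      rintro rfl
      exact h (sub_eq_zero.1 ((ZMod.val_eq_zero _).1 hk.symm)).symm
    by_cases hk1 : k = 1
    · have : (1 - d) = 1 := by
        have := ZMod.natCast_zmod_val (1 - d)
        rw [← hk, hk1] at this
        simpa using this.symm
      rw [this]
    have hk2 : k ≠ 2 := by
      rintro rfl
      have := ZMod.natCast_zmod_val (1 - d)
      rw [← hk] at this
      apply h'
      have h3 : d = 1 - (1 - d) := by ring
      rw [h3, ← this]; push_cast; ring
    obtain ⟨c, rfl⟩ : ∃ c, k = c + 3 := ⟨k - 3, by omega⟩
    obtain ⟨b, rfl⟩ : ∃ b, n = c + b + 2 := ⟨n - c - 2, by omega⟩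
    rw [clE_one, clE, eDiagram_pos _ (c + 2) b _ hk.symm (by omega)]
    change sk q (capCup (c + 2) b _) ≫ sk q (capCup 0 (c + b + 2) _) =
      sk q (capCup 0 (c + b + 2) _) ≫ sk q (capCup (c + 2) b _)
    simp only [capCup, sk_comp, Category.assoc]
    have e1 := sk_interchange q cap cap 0 c b (r := c + b + 2) (p := c) (r' := c + b) (p' := c + 2)
      (m := c + b + 2 + 2) (k := 0 + (c + b + 2)) (l := c + 2 + b) (n := c + b)
      (by simp <;> omega) (by simp <;> omega) (by simp <;> omega) (by simp <;> omega) (by simp <;> omega) (by simp <;> omega) (by simp <;> omega) (by simp <;> omega)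
      (by simp <;> omega) (by simp <;> omega) (by simp <;> omega) (by simp <;> omega)
    have e2 := sk_interchange q cap cup 0 c b (r := c + b) (p := c) (r' := c + b + 2) (p' := c + 2)
      (m := c + 2 + b) (k := c + b) (l := c + b + 2 + 2) (n := 0 + (c + b + 2))
      (by simp <;> omega) (by simp <;> omega) (by simp <;> omega) (by simp <;> omega) (by simp <;> omega) (by simp <;> omega) (by simp <;> omega) (by simp <;> omega)
      (by simp <;> omega) (by simp <;> omega) (by simp <;> omega) (by simp <;> omega)
    have e3 := sk_interchange q cup cap 0 c b (r := c + b + 2) (p := c + 2) (r' := c + b) (p' := c)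
      (m := 0 + (c + b + 2)) (k := c + b + 2 + 2) (l := c + b) (n := c + 2 + b)
      (by simp <;> omega) (by simp <;> omega) (by simp <;> omega) (by simp <;> omega) (by simp <;> omega) (by simp <;> omega) (by simp <;> omega) (by simp <;> omega)
      (by simp <;> omega) (by simp <;> omega) (by simp <;> omega) (by simp <;> omega)
    have e4 := sk_interchange q cup cup 0 c b (r := c + b) (p := c + 2) (r' := c + b + 2) (p' := c)
      (m := c + b) (k := c + 2 + b) (l := 0 + (c + b + 2)) (n := c + b + 2 + 2)
      (by simp <;> omega) (by simp <;> omega) (by simp <;> omega) (by simp <;> omega) (by simp <;> omega) (by simp <;> omega) (by simp <;> omega) (by simp <;> omega)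
      (by simp <;> omega) (by simp <;> omega) (by simp <;> omega) (by simp <;> omega)
    rw [← Category.assoc (sk q (piece cup (c + 2) b _ _)), ← e2,
      ← Category.assoc (sk q (piece cup 0 (c + b + 2) _ _)), e3]
    simp only [Category.assoc]
    rw [← e4, ← Category.assoc, ← e1, Category.assoc]
  · intro i ih
    have e : i + 1 - d = (i - d) + 1 := by ring
    rw [e, clE_succ q _ i, clE_succ q _ (i - d), conj_mul, conj_mul, ih]

/-- The ordered product `e_s e_{s+1} ⋯ e_{s+m-1}`. -/
def clProd (n : ℕ) (s : ZMod (n + 2)) : ℕ → EndS q (n + 2)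
  | 0 => 1
  | m + 1 => clProd n s m * clE q n (s + m)

lemma clProd_succ' (n : ℕ) (s : ZMod (n + 2)) (m : ℕ) :
    clProd q n s (m + 1) = clE q n s * clProd q n (s + 1) m := by
  induction m with
  | zero => simp [clProd]
  | succ m ih =>
    rw [clProd, ih, clProd, mul_assoc]
    congr 3
    push_cast; ring

lemma clProd_shift (n : ℕ) (s : ZMod (n + 2)) (m : ℕ) :
    clRho q (Nat.succ_pos (n + 1)) * clProd q n s m =
      clProd q n (s + 1) m * clRho q (Nat.succ_pos (n + 1)) := by
  induction m with
  | zero => simp [clProd]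
  | succ m ih =>
    rw [clProd, ← mul_assoc, ih, mul_assoc, clRho_mul_clE, clProd, mul_assoc]
    congr 3
    ring

lemma clProd_one (n : ℕ) (m : ℕ) (hm : m ≤ n) :
    clProd q n 1 (m + 1) =
      sk q (piece cap m (n - m) (by simp <;> omega) (by simp <;> omega) : Diagram (n + 2) n) ≫
        sk q (piece cup 0 n (by simp <;> omega) (by simp <;> omega) : Diagram n (n + 2)) := by
  induction m with
  | zero =>
    rw [clProd, clProd, one_mul, Nat.cast_zero, add_zero, clE_one,
      capCup_eq 0 n (k := n) (by omega) (by omega), sk_comp]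
    rfl
  | succ m ih =>
    rw [clProd, ih (by omega), clE, eDiagram_pos n (m + 1) (n - (m + 1)) _ _ (by omega)]
    swap
    · have : ((1 : ZMod (n + 2)) + ((m + 1 : ℕ) : ZMod (n + 2))) =
          ((m + 2 : ℕ) : ZMod (n + 2)) := by
        push_cast; ring
      rw [this, ZMod.val_natCast_of_lt (by omega)]
    change sk q (capCup _ _ _) ≫ _ ≫ _ = _
    obtain ⟨b, rfl⟩ : ∃ b, n = m + 1 + b := ⟨n - (m + 1), by omega⟩
    obtain ⟨c, hc⟩ : ∃ c, c = m + 1 + b - (m + 1) := ⟨_, rfl⟩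
    obtain ⟨d, hd⟩ : ∃ d, d = m + 1 + b - m := ⟨_, rfl⟩
    obtain rfl : c = b := by omega
    obtain rfl : d = c + 1 := by omega
    have h := sk_move q (PlanarMove.zigzag_left m c (m := m + 1 + c) (k := m + 1 + c + 2)
      (by omega) (by omega))
    rw [sk_comp, sk_id] at h
    have h' := h =≫ sk q (piece cup 0 (m + 1 + c) (by simp <;> omega) (by simp <;> omega) :
      Diagram (m + 1 + c) (m + 1 + c + 2))
    rw [Category.id_comp, Category.assoc] at h'
    simp only [← hc, ← hd]
    rw [capCup_eq (m + 1) c (k := m + 1 + c) (by omega) (by omega), sk_comp, Category.assoc, h']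

lemma clProd_top (n : ℕ) : clProd q n 1 (n + 1) =
    clRho q (Nat.succ_pos (n + 1)) ^ 2 * clE q n ((n + 1 : ℕ) : ZMod (n + 2)) := by
  rw [clProd_one q n n le_rfl, pow_two, clE, eDiagram_pos n n 0 _ _ (by omega)]
  swap
  · rw [ZMod.val_natCast_of_lt (by omega)]
  change _ = sk q (capCup n 0 _) ≫ sk q (seamCcw _) ≫ sk q (seamCcw _)
  have h1 := sk_move q (PlanarMove.seam_cup n (n := n + 2) rfl)
  simp only [sk_comp] at h1
  rw [capCup, sk_comp, Category.assoc]
  obtain ⟨d, hd⟩ : ∃ d, d = n - n := ⟨_, rfl⟩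
  obtain rfl : d = 0 := by omega
  simp only [← hd]
  exact congrArg (_ ≫ ·) h1.symm

lemma clProd_pow (n : ℕ) (m : ℕ) :
    (clRho q (Nat.succ_pos (n + 1)) * clE q n 1) ^ m =
      clRho q (Nat.succ_pos (n + 1)) ^ m * clProd q n (2 - m) m := by
  induction m with
  | zero => simp [clProd]
  | succ m ih =>
    have key : ∀ k : ℕ, ∀ i : ZMod (n + 2), clRho q (Nat.succ_pos (n + 1)) ^ k * clE q n i =
        clE q n (i + k) * clRho q (Nat.succ_pos (n + 1)) ^ k := by
      intro k
      induction k with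
      | zero => intro i; simp
      | succ k ihk =>
        intro i
        rw [pow_succ, mul_assoc, clRho_mul_clE, ← mul_assoc, ihk, mul_assoc, add_assoc,
          add_comm 1 (k : ZMod (n + 2)), ← Nat.cast_succ]
    have e : clE q n 1 * clRho q (Nat.succ_pos (n + 1)) ^ m =
        clRho q (Nat.succ_pos (n + 1)) ^ m * clE q n (1 - m) := by
      rw [key, sub_add_cancel]
    have e1 : (2 - ((m + 1 : ℕ) : ZMod (n + 2))) = 1 - m := by push_cast; ring
    have e2 : (1 - (m : ZMod (n + 2))) + 1 = 2 - m := by ring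
    rw [pow_succ' _ m, ih, mul_assoc, ← mul_assoc (clE q n 1), e, e1, clProd_succ', e2, pow_succ']
    simp only [mul_assoc]

lemma clRho_pow_rel (n : ℕ) :
    (clRho q (Nat.succ_pos (n + 1)) * clE q n 1) ^ (n + 1) =
      clRho q (Nat.succ_pos (n + 1)) ^ (n + 2) * (clRho q (Nat.succ_pos (n + 1)) * clE q n 1) := by
  have hz : ((n : ZMod (n + 2)) + 2) = 0 := by
    have := ZMod.natCast_self (n + 2)
    push_cast at this; exact this
  have e1 : (2 - ((n + 1 : ℕ) : ZMod (n + 2))) = 1 + 1 + 1 := by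
    push_cast; linear_combination -hz
  have e2 : ((n + 1 : ℕ) : ZMod (n + 2)) + 1 + 1 = 1 := by
    push_cast; linear_combination hz
  have h3 : clProd q n (1 + 1 + 1) (n + 1) * clRho q (Nat.succ_pos (n + 1)) ^ 2 =
      clRho q (Nat.succ_pos (n + 1)) ^ 2 * clProd q n 1 (n + 1) := by
    rw [pow_two, ← mul_assoc, ← clProd_shift, mul_assoc, ← clProd_shift, mul_assoc]
  have h4 : clRho q (Nat.succ_pos (n + 1)) ^ 2 * clE q n ((n + 1 : ℕ) : ZMod (n + 2)) =
      clE q n 1 * clRho q (Nat.succ_pos (n + 1)) ^ 2 := by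
    rw [pow_two, mul_assoc, clRho_mul_clE, ← mul_assoc, clRho_mul_clE, e2, mul_assoc]
  have h5 : clProd q n (1 + 1 + 1) (n + 1) = clRho q (Nat.succ_pos (n + 1)) ^ 2 * clE q n 1 := by
    have h6 : clProd q n (1 + 1 + 1) (n + 1) * clRho q (Nat.succ_pos (n + 1)) ^ 2 =
        clRho q (Nat.succ_pos (n + 1)) ^ 2 * clE q n 1 * clRho q (Nat.succ_pos (n + 1)) ^ 2 := by
      rw [h3, clProd_top, h4, mul_assoc]
    have hu : IsUnit (clRho q (Nat.succ_pos (n + 1)) ^ 2) :=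
      IsUnit.pow 2 ⟨⟨clRho q _, clRhoInv q _, clRho_mul_clRhoInv q _, clRhoInv_mul_clRho q _⟩, rfl⟩
    exact hu.mul_right_cancel h6
  rw [clProd_pow, e1, h5, ← mul_assoc, ← mul_assoc, ← pow_add, ← pow_succ]

lemma clRho_sq_rel : clRho q (Nat.succ_pos (0 + 1)) ^ 2 * clE q 0 1 = clE q 0 1 := by
  have h := clProd_top q 0
  have e : ((0 + 1 : ℕ) : ZMod (0 + 2)) = 1 := by simp
  rw [e] at h
  rw [← h, clProd, clProd, one_mul]
  simp

/-- Images of the generators. -/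
def toSkeinGen (n : ℕ) : TLGen (n + 2) → EndS q (n + 2)
  | .e i => clE q n i
  | .rho => clRho q (Nat.succ_pos (n + 1))
  | .rhoInv => clRhoInv q (Nat.succ_pos (n + 1))

lemma toSkeinGen_rel (n : ℕ) ⦃x y : FreeAlgebra ℂ (TLGen (n + 2))⦄ (h : TLRel q (n + 2) x y) :
    FreeAlgebra.lift ℂ (toSkeinGen q n) x = FreeAlgebra.lift ℂ (toSkeinGen q n) y := by
  cases h <;>
    simp only [map_mul, map_pow, map_smul, map_one, FreeAlgebra.lift_ι_apply, toSkeinGen]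
  case e_sq i => exact clE_sq q n i
  case e_comm hn i j h h' => exact clE_comm q n hn i j h h'
  case e_succ hn i => exact clE_braid_succ q n hn i
  case e_pred hn i => exact clE_braid_pred q n hn i
  case rho_e i => exact clRho_mul_clE q n i
  case rho_rhoInv => exact clRho_mul_clRhoInv q _
  case rhoInv_rho => exact clRhoInv_mul_clRho q _
  case rho_sq_e hn =>
    obtain rfl : n = 0 := by omega
    exact clRho_sq_rel q
  case rho_e_pow hn => exact clRho_pow_rel q n

/-- The class of `ρ` as a unit. -/
def clRhoUnit {n : ℕ} (hn : 0 < n) : (EndS q n)ˣ :=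
  ⟨clRho q hn, clRhoInv q hn, clRho_mul_clRhoInv q hn, clRhoInv_mul_clRho q hn⟩

/-- The algebra map `TL_n → End_S(n)` that sends the generators to the classes of their diagrams; it
identifies `TL_n` with the skein algebra `End_S(n)`. -/
def toSkein : ∀ n, TL q n →ₐ[ℂ] EndS q n
  | 0 => (Polynomial.aeval (sk q loopDiagram : EndS q 0) : Polynomial ℂ →ₐ[ℂ] EndS q 0)
  | 1 => (AddMonoidAlgebra.lift ℂ (EndS q 1) ℤ
      ((Units.coeHom (EndS q 1)).comp (zpowersHom _ (clRhoUnit q Nat.one_pos))) :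
        LaurentPolynomial ℂ →ₐ[ℂ] EndS q 1)
  | n + 2 => (RingQuot.liftAlgHom ℂ ⟨FreeAlgebra.lift ℂ (toSkeinGen q n), toSkeinGen_rel q n⟩ :
      RingQuot (TLRel q (n + 2)) →ₐ[ℂ] EndS q (n + 2))

theorem toSkein_X : toSkein q 0 (TL.X q) = sk q loopDiagram :=
  Polynomial.aeval_X (R := ℂ) (A := EndS q 0) (sk q loopDiagram)

theorem toSkein_rho (n : ℕ) (hn : 0 < n) : toSkein q n (TL.rho q n) = sk q (seamCcw hn) := by
  match n, hn with
  | 1, _ =>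
    refine (AddMonoidAlgebra.lift_single _ _ _).trans ?_
    simp [clRhoUnit, clRho]
  | n + 2, _ =>
    refine (RingQuot.liftAlgHom_mkAlgHom_apply ℂ _ _ _).trans ?_
    rw [FreeAlgebra.lift_ι_apply]; rfl

theorem toSkein_rhoInv (n : ℕ) (hn : 0 < n) :
    toSkein q n (TL.rhoInv q n) = sk q (seamCw hn) := by
  match n, hn with
  | 1, _ =>
    refine (AddMonoidAlgebra.lift_single _ _ _).trans ?_
    simp [clRhoUnit, clRhoInv]
  | n + 2, _ =>
    refine (RingQuot.liftAlgHom_mkAlgHom_apply ℂ _ _ _).trans ?_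
    rw [FreeAlgebra.lift_ι_apply]; rfl

theorem toSkein_e (n : ℕ) (i : ZMod (n + 2)) :
    toSkein q (n + 2) (TL.e q (n + 2) i) = sk q (eDiagram n i) := by
  refine (RingQuot.liftAlgHom_mkAlgHom_apply ℂ _ _ _).trans ?_
  rw [FreeAlgebra.lift_ι_apply]; rfl

end Realization

end

end AnnularSkein

open AnnularSkein

/-! Let `q = t^{1/4}` and let the source algebra have `N` strands. The strand of `ρ` that crosses
the seam meets the inserted arc once. Resolving this crossing by the Kauffman relation gives `R = ρ
g_N` with `g_i = q⁻¹ e_i + q`. The diagrams of `e_1, …, e_{N-1}` avoid the seam and keep their form,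
while the image of `e_N` is `g_N⁻¹ e_{N+1} g_N`. It remains to show that these formulas respect the
relations of `TL_N`, which is pure algebra, and that the resulting maps match arc insertion of
diagrams.

For the relations, the loop value makes `g_N`, hence `R`, invertible. The main computation is
`TL.insRho_mul_insE`: `R` conjugates the image of `e_i` to that of `e_{i+1}`, cyclically modulo `N`.
The quadratic, commutation and braid relations therefore need checking at a single position. With
one index equal to 1, all images involved are plain generators of `TL_{N+1}`.

Given the rotation rule, the relation on `(ρ e_1)^{N-1}` is equivalent to `e_1 ⋯ e_{N-1} = ρ²
e_{N-1}` (`units_mul_cyclic_pow_eq_iff`); for `N = 2` this is the relation `ρ² e_1 = e_1`. In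
`TL_{N+1}` one has `e_1 ⋯ e_{N-1} = e_1 ⋯ e_{N-1} e_N e_{N-1} = ρ² e_N e_{N-1} = ρ² g_{N-1} g_N
e_{N-1} = R² e_{N-1}`, which is `TL.cyclicProd_insE_eq`.

For the comparison with diagrams, both composites are algebra maps, and for `N ≥ 2` the elements
`e_1, ρ, ρ⁻¹` generate `TL_N`. So it suffices to insert an arc into the diagrams of these three
(`toSkein_insHom`); the formula for `e_N` then comes for free. For `N = 0` the curve around the hole
acquires one crossing, whose two smoothings straighten to `ρ` and `ρ⁻¹` (`sk_ins_loopDiagram`). -/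

namespace AnnularSkein

open CategoryTheory LocalPiece

/-! ### Products over a cyclic family rotated by a unit -/

section CyclicProducts

variable {A : Type*} [Ring A] {n : ℕ} (e : ZMod (n + 2) → A)

/-- The ordered product `e_s e_{s+1} ⋯ e_{s+m-1}` of a cyclically indexed family. -/
def cyclicProd (s : ZMod (n + 2)) : ℕ → A
  | 0 => 1
  | m + 1 => cyclicProd s m * e (s + m)

lemma cyclicProd_succ' (s : ZMod (n + 2)) (m : ℕ) :
    cyclicProd e s (m + 1) = e s * cyclicProd e (s + 1) m := by
  induction m with
  | zero => simp [cyclicProd]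
  | succ m ih =>
    rw [cyclicProd, ih, cyclicProd, mul_assoc]
    congr 3
    push_cast; ring

lemma cyclicProd_one_succ (m : ℕ) :
    cyclicProd e 1 (m + 1) = cyclicProd e 1 m * e ((m + 1 : ℕ) : ZMod (n + 2)) := by
  rw [cyclicProd, Nat.cast_succ, add_comm (m : ZMod (n + 2))]

variable {e} {u : Aˣ} (hu : ∀ i, ↑u * e i = e (i + 1) * u)
include hu

lemma units_mul_cyclicProd (s : ZMod (n + 2)) (m : ℕ) :
    ↑u * cyclicProd e s m = cyclicProd e (s + 1) m * u := by
  induction m with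
  | zero => simp [cyclicProd]
  | succ m ih =>
    rw [cyclicProd, ← mul_assoc, ih, mul_assoc, hu, cyclicProd, mul_assoc]
    congr 3
    ring

lemma units_pow_mul_cyclic (k : ℕ) (i : ZMod (n + 2)) :
    (u : A) ^ k * e i = e (i + k) * (u : A) ^ k := by
  induction k generalizing i with
  | zero => simp
  | succ k ih =>
    rw [pow_succ, mul_assoc, hu, ← mul_assoc, ih, mul_assoc, add_assoc,
      add_comm 1 (k : ZMod (n + 2)), ← Nat.cast_succ]

/-- Moving every `u` to the left lowers the indices of the factors `e 1` it passes, so they become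
`e (2 - m), …, e 0, e 1` in increasing order. -/
lemma units_mul_cyclic_pow (m : ℕ) :
    (↑u * e 1) ^ m = (u : A) ^ m * cyclicProd e (2 - m) m := by
  induction m with
  | zero => simp [cyclicProd]
  | succ m ih =>
    have h : e 1 * (u : A) ^ m = (u : A) ^ m * e (1 - m) := by
      rw [units_pow_mul_cyclic hu, sub_add_cancel]
    have h1 : (2 - ((m + 1 : ℕ) : ZMod (n + 2))) = 1 - m := by push_cast; ring
    have h2 : (1 - (m : ZMod (n + 2))) + 1 = 2 - m := by ring
    rw [pow_succ' _ m, ih, mul_assoc, ← mul_assoc (e 1), h, h1, cyclicProd_succ', h2, pow_succ']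
    simp only [mul_assoc]

/-- The relation `(ρ e_1)^{N-1} = ρ^N (ρ e_1)` says that `e_1 ⋯ e_{N-1} = ρ² e_{N-1}`. -/
lemma units_mul_cyclic_pow_eq_iff :
    (↑u * e 1) ^ (n + 1) = (u : A) ^ (n + 2) * (↑u * e 1) ↔
      cyclicProd e 1 (n + 1) = (u : A) ^ 2 * e ((n + 1 : ℕ) : ZMod (n + 2)) := by
  have hz : ((n : ZMod (n + 2)) + 2) = 0 := by
    have := ZMod.natCast_self (n + 2)
    push_cast at this; exact this
  -- For the exponent `n + 1` the product starts at `2 - (n + 1)`, which is 3 modulo `n + 2`; it is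
  -- thus the product starting at 1, rotated twice.
  have h1 : (2 - ((n + 1 : ℕ) : ZMod (n + 2))) = 1 + 1 + 1 := by
    push_cast; linear_combination -hz
  have h2 : ((n + 1 : ℕ) : ZMod (n + 2)) + (2 : ℕ) = 1 := by
    push_cast; linear_combination hz
  have h3 : cyclicProd e (1 + 1 + 1) (n + 1) * (u : A) ^ 2 =
      (u : A) ^ 2 * cyclicProd e 1 (n + 1) := by
    rw [pow_two, ← mul_assoc, ← units_mul_cyclicProd hu, mul_assoc, ← units_mul_cyclicProd hu,
      mul_assoc]
  have h4 := units_pow_mul_cyclic hu 2 ((n + 1 : ℕ) : ZMod (n + 2))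
  rw [h2] at h4
  have cancelL : ∀ (k : ℕ) (x y : A), (u : A) ^ k * x = (u : A) ^ k * y ↔ x = y := fun k x y => by
    rw [← Units.val_pow_eq_pow_val]; exact Units.mul_right_inj _
  have cancelR : ∀ x y : A, x * (u : A) ^ 2 = y * (u : A) ^ 2 ↔ x = y := fun x y => by
    rw [← Units.val_pow_eq_pow_val]; exact Units.mul_left_inj _
  -- Cancelling `u ^ (n + 1)` leaves `e_3 ⋯ e_{n+3} = u² e_1`. Multiplying by `u²` on the right and
  -- pulling it through to the left rotates both sides back by two, and `u²` cancels.
  rw [units_mul_cyclic_pow hu, h1, ← mul_assoc, ← pow_succ, show n + 2 + 1 = (n + 1) + 2 from rfl,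
    pow_add _ (n + 1) 2, mul_assoc, cancelL, ← cancelR, h3, mul_assoc, ← h4, cancelL]

end CyclicProducts

/-! ### Resolved crossings -/

section BraidElements

variable {A : Type*} [Ring A] [Algebra ℂ A] (q : ℂˣ)

/-- The resolution of the crossing between two neighbouring strands joined by `x`. -/
noncomputable def braidElt (x : A) : A := (q : ℂ)⁻¹ • x + (q : ℂ) • 1

/-- The resolution of the opposite crossing. -/
noncomputable def braidEltInv (x : A) : A := (q : ℂ) • x + (q : ℂ)⁻¹ • 1

variable {q} {x y : A}

/-- The second Reidemeister move: the coefficient of `x` is `loopValue q + q² + q⁻²`, which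
vanishes. -/
lemma braidElt_mul_braidEltInv (hx : x * x = loopValue q • x) :
    braidElt q x * braidEltInv q x = 1 := by
  have hq : (q : ℂ) ≠ 0 := q.ne_zero
  simp only [braidElt, braidEltInv, mul_add, add_mul, smul_mul_smul, hx, mul_one, one_mul,
    smul_smul, loopValue]
  match_scalars <;> simp <;> field_simp <;> ring

lemma braidEltInv_mul_braidElt (hx : x * x = loopValue q • x) :
    braidEltInv q x * braidElt q x = 1 := by
  have hq : (q : ℂ) ≠ 0 := q.ne_zero
  simp only [braidElt, braidEltInv, mul_add, add_mul, smul_mul_smul, hx, mul_one, one_mul,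
    smul_smul, loopValue]
  match_scalars <;> simp <;> field_simp <;> ring

/-- Algebraic form of sliding an arc off a strand that crosses it twice: in the expansion all
multiples of `x` cancel, again by the choice of `loopValue q`. The next lemma is the mirror version,
with the arc on the other side. -/
lemma mul_braidElt_mul_braidElt (hx : x * x = loopValue q • x) (hxy : x * y * x = x) :
    x * (braidElt q y * braidElt q x) = x * y := by
  have hq : (q : ℂ) ≠ 0 := q.ne_zero
  simp only [braidElt, mul_add, add_mul, mul_smul_comm, smul_mul_assoc,
    ← mul_assoc, hxy, hx, mul_one, one_mul, smul_smul, loopValue]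
  match_scalars <;> simp <;> field_simp <;> ring

lemma braidElt_mul_braidElt_mul (hy : y * y = loopValue q • y) (hyx : y * x * y = y) :
    braidElt q y * braidElt q x * y = x * y := by
  have hq : (q : ℂ) ≠ 0 := q.ne_zero
  simp only [braidElt, mul_add, add_mul, mul_smul_comm, smul_mul_assoc,
    hyx, hy, mul_one, one_mul, smul_smul, loopValue]
  match_scalars <;> simp <;> field_simp <;> ring

lemma commute_braidElt_left (h : Commute x y) : Commute (braidElt q x) y :=
  (h.smul_left _).add_left ((Commute.one_left y).smul_left _)

lemma mul_braidElt_of_mul_eq {r : A} (h : r * x = y * r) :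
    r * braidElt q x = braidElt q y * r := by
  simp only [braidElt, mul_add, add_mul, mul_smul_comm, smul_mul_assoc, h, mul_one, one_mul]

end BraidElements

/-! ### Generators of the Temperley–Lieb algebras and their images under insertion -/

namespace TL

variable (q : ℂˣ)

lemma e_mul_self (n : ℕ) (i : ZMod (n + 2)) :
    e q (n + 2) i * e q (n + 2) i = loopValue q • e q (n + 2) i := by
  have h := RingQuot.mkAlgHom_rel ℂ (TLRel.e_sq (q := q) i)
  simp only [map_mul, map_smul] at h
  exact h

lemma e_commute (n : ℕ) (i j : ZMod (n + 3)) (h : i - j ≠ 1) (h' : i - j ≠ -1) :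
    Commute (e q (n + 3) i) (e q (n + 3) j) := by
  have h := RingQuot.mkAlgHom_rel ℂ (TLRel.e_comm (q := q) (by omega) i j h h')
  simp only [map_mul] at h
  exact h

lemma e_mul_e_succ_mul_e (n : ℕ) (i : ZMod (n + 3)) :
    e q (n + 3) i * e q (n + 3) (i + 1) * e q (n + 3) i = e q (n + 3) i := by
  have h := RingQuot.mkAlgHom_rel ℂ (TLRel.e_succ (q := q) (by omega) i)
  simp only [map_mul] at h
  exact h

lemma e_mul_e_pred_mul_e (n : ℕ) (i : ZMod (n + 3)) :
    e q (n + 3) (i + 1) * e q (n + 3) i * e q (n + 3) (i + 1) = e q (n + 3) (i + 1) := by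
  have h := RingQuot.mkAlgHom_rel ℂ (TLRel.e_pred (q := q) (by omega) (i + 1))
  rw [add_sub_cancel_right] at h
  simp only [map_mul] at h
  exact h

lemma rho_mul_e (n : ℕ) (i : ZMod (n + 2)) :
    rho q (n + 2) * e q (n + 2) i = e q (n + 2) (i + 1) * rho q (n + 2) := by
  have h := RingQuot.mkAlgHom_rel ℂ (TLRel.rho_e (q := q) i)
  simp only [map_mul] at h
  exact h

/-- The generator `ρ` as a unit. -/
noncomputable def rhoUnit (n : ℕ) : (TL q (n + 2))ˣ where
  val := rho q (n + 2)
  inv := rhoInv q (n + 2)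
  val_inv := by
    have h := RingQuot.mkAlgHom_rel ℂ (TLRel.rho_rhoInv (q := q) (n := n + 2))
    simp only [map_mul, map_one] at h
    exact h
  inv_val := by
    have h := RingQuot.mkAlgHom_rel ℂ (TLRel.rhoInv_rho (q := q) (n := n + 2))
    simp only [map_mul, map_one] at h
    exact h

lemma cyclicProd_e (n : ℕ) : cyclicProd (e q (n + 3)) 1 (n + 2) =
    rho q (n + 3) ^ 2 * e q (n + 3) ((n + 2 : ℕ) : ZMod (n + 3)) := by
  refine (units_mul_cyclic_pow_eq_iff (u := rhoUnit q (n + 1)) (rho_mul_e q (n + 1))).1 ?_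
  have h := RingQuot.mkAlgHom_rel ℂ (TLRel.rho_e_pow (q := q) (n := n + 3) (by omega))
  simp only [map_mul, map_pow] at h
  exact h

/-- The unit `ρ (t^{-1/4} e_n + t^{1/4})` of `TL_{n+1}`. -/
noncomputable def insRho (n : ℕ) : (TL q (n + 2))ˣ :=
  rhoUnit q n *
    ⟨braidElt q (e q (n + 2) ((n + 1 : ℕ) : ZMod (n + 2))),
      braidEltInv q (e q (n + 2) ((n + 1 : ℕ) : ZMod (n + 2))),
      braidElt_mul_braidEltInv (e_mul_self q n _), braidEltInv_mul_braidElt (e_mul_self q n _)⟩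

lemma coe_insRho (n : ℕ) : (insRho q n : TL q (n + 2)) =
    rho q (n + 2) * braidElt q (e q (n + 2) ((n + 1 : ℕ) : ZMod (n + 2))) := rfl

lemma coe_inv_insRho (n : ℕ) : (((insRho q n)⁻¹ : (TL q (n + 2))ˣ) : TL q (n + 2)) =
    braidEltInv q (e q (n + 2) ((n + 1 : ℕ) : ZMod (n + 2))) * rhoInv q (n + 2) := rfl

/-- The images of the generators `e_i` of `TL_{n+2}` under arc insertion. -/
noncomputable def insE (n : ℕ) (i : ZMod (n + 2)) : TL q (n + 3) :=
  if i.val = 0 then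
    braidEltInv q (e q (n + 3) ((n + 2 : ℕ) : ZMod (n + 3))) *
      e q (n + 3) ((n + 3 : ℕ) : ZMod (n + 3)) *
      braidElt q (e q (n + 3) ((n + 2 : ℕ) : ZMod (n + 3)))
  else e q (n + 3) (i.val : ZMod (n + 3))

lemma insE_of_val_eq_zero (n : ℕ) (i : ZMod (n + 2)) (h : i.val = 0) : insE q n i =
    braidEltInv q (e q (n + 3) ((n + 2 : ℕ) : ZMod (n + 3))) *
      e q (n + 3) ((n + 3 : ℕ) : ZMod (n + 3)) *
      braidElt q (e q (n + 3) ((n + 2 : ℕ) : ZMod (n + 3))) := if_pos h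

lemma insE_natCast (n k : ℕ) (hk : 0 < k) (hk' : k < n + 2) :
    insE q n (k : ZMod (n + 2)) = e q (n + 3) (k : ZMod (n + 3)) := by
  have h : (k : ZMod (n + 2)).val = k := ZMod.val_natCast_of_lt hk'
  rw [insE, if_neg (by omega), h]

lemma insE_one (n : ℕ) : insE q n 1 = e q (n + 3) 1 := by
  have h := insE_natCast q n 1 (by omega) (by omega)
  rwa [Nat.cast_one, Nat.cast_one] at h

lemma rho_mul_e_natCast (n k : ℕ) : rho q (n + 2) * e q (n + 2) (k : ZMod (n + 2)) =
    e q (n + 2) ((k + 1 : ℕ) : ZMod (n + 2)) * rho q (n + 2) := by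
  rw [rho_mul_e, Nat.cast_succ]

/-- Here `2 ≤ k - j ≤ n + 1`, so neither `k - j - 1` nor `k - j + 1` is divisible by `n + 3`, and
the indices are not cyclic neighbours. -/
lemma e_commute_natCast (n j k : ℕ) (h : j + 2 ≤ k) (h' : k < j + n + 2) :
    Commute (e q (n + 3) (k : ZMod (n + 3))) (e q (n + 3) (j : ZMod (n + 3))) := by
  obtain ⟨d, rfl⟩ := Nat.exists_eq_add_of_le (show j ≤ k by omega)
  have key : ∀ m : ℕ, 0 < m → m < n + 3 → (m : ZMod (n + 3)) ≠ 0 := fun m h0 h1 h2 => by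
    rw [ZMod.natCast_eq_zero_iff] at h2
    exact absurd (Nat.le_of_dvd h0 h2) (by omega)
  refine e_commute q n _ _ (fun h1 => ?_) (fun h1 => ?_)
  · refine key (d - 1) (by omega) (by omega) ?_
    rw [Nat.cast_sub (by omega)]
    push_cast at h1 ⊢
    linear_combination h1
  · refine key (d + 1) (by omega) (by omega) ?_
    push_cast at h1 ⊢
    linear_combination h1

/-- There are three cases. From `i = 0` the inner factors `g g⁻¹` cancel and `ρ` carries `e_{n+3}`
to `e_1`. For `1 ≤ i ≤ n` the crossing is far from `e_i` and commutes with it. The case `i = n + 1`,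
where the image enters the seam, is the one that needs the sliding identities. -/
lemma insRho_mul_insE (n : ℕ) (i : ZMod (n + 2)) :
    (insRho q (n + 1) : TL q (n + 3)) * insE q n i = insE q n (i + 1) * insRho q (n + 1) := by
  have hl := ZMod.val_lt i
  have hv := zmod_val_succ i
  have hi := ZMod.natCast_zmod_val i
  have hg : braidElt q (e q (n + 3) ((n + 2 : ℕ) : ZMod (n + 3))) *
      braidEltInv q (e q (n + 3) ((n + 2 : ℕ) : ZMod (n + 3))) = 1 :=
    braidElt_mul_braidEltInv (e_mul_self q (n + 1) _)
  have hrho : ∀ k : ℕ, rho q (n + 3) * e q (n + 3) (k : ZMod (n + 3)) =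
    e q (n + 3) ((k + 1 : ℕ) : ZMod (n + 3)) * rho q (n + 3) := rho_mul_e_natCast q (n + 1)
  rw [coe_insRho]
  change rho q (n + 3) * braidElt q (e q (n + 3) ((n + 2 : ℕ) : ZMod (n + 3))) * _ =
    _ * (rho q (n + 3) * braidElt q (e q (n + 3) ((n + 2 : ℕ) : ZMod (n + 3))))
  rcases Nat.eq_zero_or_pos i.val with h0 | h0
  · have h1 : i + 1 = 1 := by rw [← hi, h0]; simp
    -- The index 1 is written as `n + 4` so that it is visibly the successor of `n + 3`.
    have h2 : ((n + 3 + 1 : ℕ) : ZMod (n + 3)) = 1 := by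
      rw [Nat.cast_add, ZMod.natCast_self]; simp
    rw [insE_of_val_eq_zero q n i h0, h1, insE_one, ← h2, ← mul_assoc (e q (n + 3) _) (rho q (n + 3)),
      ← hrho]
    simp only [mul_assoc]
    rw [← mul_assoc (braidElt q _) (braidEltInv q _), hg, one_mul]
  · obtain ⟨k, hk⟩ : ∃ k, k = i.val := ⟨_, rfl⟩
    rw [← hk] at hv h0 hl hi
    rw [← hi, insE_natCast q n k h0 hl, hi]
    by_cases h1 : k = n + 1
    · subst h1
      rw [if_pos rfl] at hv
      have hb : rho q (n + 3) * braidElt q (e q (n + 3) ((n + 1 : ℕ) : ZMod (n + 3))) =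
          braidElt q (e q (n + 3) ((n + 2 : ℕ) : ZMod (n + 3))) * rho q (n + 3) :=
        mul_braidElt_of_mul_eq (hrho (n + 1))
      have hs := e_mul_self q (n + 1)
      have hc : ((n + 2 : ℕ) : ZMod (n + 3)) = ((n + 1 : ℕ) : ZMod (n + 3)) + 1 := by
        push_cast; ring
      have h1 := mul_braidElt_mul_braidElt (q := q)
        (hs ((n + 2 : ℕ) : ZMod (n + 3))) (y := e q (n + 3) ((n + 1 : ℕ) : ZMod (n + 3)))
        (by rw [hc]; exact e_mul_e_pred_mul_e q n _)
      have h2 := braidElt_mul_braidElt_mul (q := q) (hs ((n + 1 : ℕ) : ZMod (n + 3)))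
        (x := e q (n + 3) ((n + 2 : ℕ) : ZMod (n + 3)))
        (by rw [hc]; exact e_mul_e_succ_mul_e q n _)
      have hg' : braidEltInv q (e q (n + 3) ((n + 2 : ℕ) : ZMod (n + 3))) *
          braidElt q (e q (n + 3) ((n + 2 : ℕ) : ZMod (n + 3))) = 1 :=
        braidEltInv_mul_braidElt (hs _)
      rw [insE_of_val_eq_zero q n _ hv]
      set r := rho q (n + 3)
      set x := e q (n + 3) ((n + 2 : ℕ) : ZMod (n + 3))
      set y := e q (n + 3) ((n + 1 : ℕ) : ZMod (n + 3))
      -- Inserting `g_x⁻¹ g_x` in front and using `g_x r = r g_y` creates `g_y g_x y`. This equals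
      -- `x y = x g_y g_x`, so `y` is traded for `x` on the left of the two crossings, and `r` turns
      -- `x` into `e_{n+3}`.
      calc r * braidElt q x * y
          = braidEltInv q x * (braidElt q x * r) * braidElt q x * y := by
            rw [← mul_assoc (braidEltInv q x), hg', one_mul]
        _ = braidEltInv q x * r * (braidElt q y * braidElt q x * y) := by
            rw [← hb]; simp only [mul_assoc]
        _ = braidEltInv q x * (r * x) * (braidElt q y * braidElt q x) := by
            rw [h2, ← h1]; simp only [mul_assoc]
        _ = braidEltInv q x * e q (n + 3) ((n + 3 : ℕ) : ZMod (n + 3)) *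
            (r * braidElt q y) * braidElt q x := by
            rw [hrho (n + 2)]; simp only [mul_assoc]
        _ = _ := by rw [hb]; simp only [mul_assoc]
    · have h2 : i + 1 = ((k + 1 : ℕ) : ZMod (n + 2)) := by rw [← hi, Nat.cast_succ]
      rw [h2, insE_natCast q n (k + 1) (by omega) (by omega), mul_assoc,
        (commute_braidElt_left (e_commute_natCast q n k (n + 2) (by omega) (by omega))).eq, ← mul_assoc,
        hrho, mul_assoc]

end TL

/-! ### The Temperley–Lieb relations for the images -/

lemma units_conj_mul {A : Type*} [Ring A] (u : Aˣ) (x y : A) :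
    (u * x * ↑u⁻¹) * (u * y * ↑u⁻¹) = u * (x * y) * ↑u⁻¹ := by
  simp only [mul_assoc, Units.inv_mul_cancel_left]

namespace TL

variable (q : ℂˣ)

lemma insE_succ (n : ℕ) (i : ZMod (n + 2)) : insE q n (i + 1) =
    (insRho q (n + 1) : TL q (n + 3)) * insE q n i * ((insRho q (n + 1))⁻¹ : (TL q (n + 3))ˣ) := by
  rw [insRho_mul_insE, mul_assoc, Units.mul_inv, mul_one]

lemma insE_mul_self (n : ℕ) (i : ZMod (n + 2)) :
    insE q n i * insE q n i = loopValue q • insE q n i := by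
  refine zmod_induction (P := fun i => insE q n i * insE q n i = loopValue q • insE q n i)
    1 ?_ (fun i h => ?_) i
  · rw [insE_one]
    exact e_mul_self q (n + 1) 1
  · rw [insE_succ, units_conj_mul, h, mul_smul_comm, smul_mul_assoc]

/-- The source needs at least three strands: on two strands the index 2 is 0, whose image is not a
generator. The braid relations are only required from three strands on. -/
lemma insE_two (n : ℕ) : insE q (n + 1) (1 + 1) = e q (n + 4) (1 + 1) := by
  have h := insE_natCast q (n + 1) 2 (by omega) (by omega)
  rwa [Nat.cast_two, Nat.cast_two, ← one_add_one_eq_two (R := ZMod (n + 1 + 2)),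
    ← one_add_one_eq_two (R := ZMod (n + 4))] at h

lemma insE_mul_insE_succ_mul_insE (n : ℕ) (i : ZMod (n + 3)) :
    insE q (n + 1) i * insE q (n + 1) (i + 1) * insE q (n + 1) i = insE q (n + 1) i := by
  refine zmod_induction (P := fun i => insE q (n + 1) i * insE q (n + 1) (i + 1) *
    insE q (n + 1) i = insE q (n + 1) i) 1 ?_ (fun i h => ?_) i
  · rw [insE_two, insE_one]
    exact e_mul_e_succ_mul_e q (n + 1) 1
  · have h' := congrArg (fun x => (insRho q (n + 2) : TL q (n + 4)) * x *
      ((insRho q (n + 2))⁻¹ : (TL q (n + 4))ˣ)) h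
    simpa only [← units_conj_mul, ← insE_succ q (n + 1)] using h'

lemma insE_mul_insE_pred_mul_insE (n : ℕ) (i : ZMod (n + 3)) :
    insE q (n + 1) (i + 1) * insE q (n + 1) i * insE q (n + 1) (i + 1) =
      insE q (n + 1) (i + 1) := by
  refine zmod_induction (P := fun i => insE q (n + 1) (i + 1) * insE q (n + 1) i *
    insE q (n + 1) (i + 1) = insE q (n + 1) (i + 1)) 1 ?_ (fun i h => ?_) i
  · rw [insE_two, insE_one]
    exact e_mul_e_pred_mul_e q (n + 1) 1
  · have h' := congrArg (fun x => (insRho q (n + 2) : TL q (n + 4)) * x *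
      ((insRho q (n + 2))⁻¹ : (TL q (n + 4))ˣ)) h
    simpa only [← units_conj_mul, ← insE_succ q (n + 1)] using h'

lemma insE_commute (n : ℕ) (i j : ZMod (n + 3)) (h : i - j ≠ 1) (h' : i - j ≠ -1) :
    insE q (n + 1) i * insE q (n + 1) j = insE q (n + 1) j * insE q (n + 1) i := by
  -- Fixing the difference `d = i - j` makes the claim invariant under rotation, so it may be
  -- checked at `i = 1`.
  suffices H : ∀ d : ZMod (n + 3), d ≠ 1 → d ≠ -1 → ∀ i,
      insE q (n + 1) i * insE q (n + 1) (i - d) = insE q (n + 1) (i - d) * insE q (n + 1) i by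
    have := H (i - j) h h' i
    rwa [sub_sub_cancel] at this
  clear h h' i j
  intro d h h' i
  refine zmod_induction (P := fun i => insE q (n + 1) i * insE q (n + 1) (i - d) =
    insE q (n + 1) (i - d) * insE q (n + 1) i) 1 ?_ (fun i ih => ?_) i
  · obtain ⟨k, hk, hkd⟩ : ∃ k : ℕ, k < n + 3 ∧ (k : ZMod (n + 3)) = 1 - d :=
      ⟨(1 - d).val, ZMod.val_lt _, ZMod.natCast_zmod_val _⟩
    rw [← hkd]
    -- The index 0, the only one whose image is not a generator, is a neighbour of 1 and hence
    -- excluded, as is 2. Apart from the trivial `k = 1`, this leaves distant generators of the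
    -- larger algebra.
    have hk0 : k ≠ 0 := by
      rintro rfl
      exact h (by push_cast at hkd; linear_combination hkd)
    have hk2 : k ≠ 2 := by
      rintro rfl
      exact h' (by push_cast at hkd; linear_combination hkd)
    by_cases hk1 : k = 1
    · rw [hk1, Nat.cast_one]
    rw [insE_natCast q (n + 1) k (by omega) hk, insE_one]
    have := e_commute_natCast q (n + 1) 1 k (by omega) (by omega)
    rw [Nat.cast_one] at this
    exact this.symm
  · have e : i + 1 - d = (i - d) + 1 := by ring
    rw [e, insE_succ q _ i, insE_succ q _ (i - d), units_conj_mul, units_conj_mul, ih]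

/-- The bound on `m` keeps the product short of the index `n + 2`, which is 0 in the source. -/
lemma cyclicProd_insE (n m : ℕ) (hm : m ≤ n + 1) :
    cyclicProd (insE q n) 1 m = cyclicProd (e q (n + 3)) 1 m := by
  induction m with
  | zero => rfl
  | succ m ih =>
    have h := insE_natCast q n (m + 1) (by omega) (by omega)
    rw [cyclicProd_one_succ, ih (by omega), h]
    exact (cyclicProd_one_succ _ m).symm

/-- The long relation on `n + 2` strands is inherited from the one on `n + 3` strands. Since the
latter has at least three strands, the case `n = 0` is covered as well and yields the special
relation of `TL_2`. -/
lemma cyclicProd_insE_eq (n : ℕ) : cyclicProd (insE q n) 1 (n + 1) =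
    (insRho q (n + 1) : TL q (n + 3)) ^ 2 * insE q n ((n + 1 : ℕ) : ZMod (n + 2)) := by
  have hs := e_mul_self q (n + 1)
  have hc : ((n + 2 : ℕ) : ZMod (n + 3)) = ((n + 1 : ℕ) : ZMod (n + 3)) + 1 := by
    push_cast; ring
  have h1 := braidElt_mul_braidElt_mul (q := q) (hs ((n + 1 : ℕ) : ZMod (n + 3)))
    (x := e q (n + 3) ((n + 2 : ℕ) : ZMod (n + 3)))
    (by rw [hc]; exact e_mul_e_succ_mul_e q n _)
  have h2 := mul_braidElt_of_mul_eq (q := q) (rho_mul_e_natCast q (n + 1) (n + 1))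
  have h3 := e_mul_e_succ_mul_e q n ((n + 1 : ℕ) : ZMod (n + 3))
  rw [← hc] at h3
  have h4 := cyclicProd_e q n
  have h6 : cyclicProd (e q (n + 3)) 1 (n + 1) = cyclicProd (e q (n + 3)) 1 n *
      e q (n + 3) ((n + 1 : ℕ) : ZMod (n + 3)) :=
    cyclicProd_one_succ _ n
  have h5 : cyclicProd (e q (n + 3)) 1 (n + 2) = cyclicProd (e q (n + 3)) 1 n *
      e q (n + 3) ((n + 1 : ℕ) : ZMod (n + 3)) * e q (n + 3) ((n + 2 : ℕ) : ZMod (n + 3)) := by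
    rw [← h6]
    exact cyclicProd_one_succ _ (n + 1)
  rw [cyclicProd_insE q n _ le_rfl, insE_natCast q n (n + 1) (by omega) (by omega), coe_insRho]
  change _ = (rho q (n + 3) * braidElt q (e q (n + 3) ((n + 2 : ℕ) : ZMod (n + 3)))) ^ 2 * _
  change rho q (n + 3) * _ = _ * rho q (n + 3) at h2
  change _ = braidElt q (e q (n + 3) ((n + 2 : ℕ) : ZMod (n + 3))) * _ at h2
  set r := rho q (n + 3)
  set x := e q (n + 3) ((n + 2 : ℕ) : ZMod (n + 3))
  set y := e q (n + 3) ((n + 1 : ℕ) : ZMod (n + 3))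
  -- The last factor `y` is expanded to `y x y`, so that the full product `e_1 ⋯ e_{n+2}` appears
  -- and becomes `r² x`. Then `x y = g_y g_x y`, and `r g_y = g_x r` distributes the two crossings
  -- over the two rotations.
  calc cyclicProd (e q (n + 3)) 1 (n + 1) = r ^ 2 * (x * y) := by
        rw [← mul_assoc, ← h4, h5, h6]
        simp only [mul_assoc] at h3 ⊢
        rw [h3]
    _ = r * (r * braidElt q y) * braidElt q x * y := by
        rw [← h1]; simp only [pow_two, mul_assoc]
    _ = _ := by rw [h2]; simp only [pow_two, mul_assoc]

/-! ### The algebra maps -/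

/-- Arc insertion on the generators of `TL_{n+2}`. -/
noncomputable def insGen (n : ℕ) : TLGen (n + 2) → TL q (n + 3)
  | .e i => insE q n i
  | .rho => insRho q (n + 1)
  | .rhoInv => ((insRho q (n + 1))⁻¹ : (TL q (n + 3))ˣ)

lemma insGen_rel (n : ℕ) ⦃x y : FreeAlgebra ℂ (TLGen (n + 2))⦄ (h : TLRel q (n + 2) x y) :
    FreeAlgebra.lift ℂ (insGen q n) x = FreeAlgebra.lift ℂ (insGen q n) y := by
  have hpow := (units_mul_cyclic_pow_eq_iff (insRho_mul_insE q n)).2 (cyclicProd_insE_eq q n)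
  cases h <;>
    simp only [map_mul, map_pow, map_smul, map_one, FreeAlgebra.lift_ι_apply, insGen]
  case e_sq i => exact insE_mul_self q n i
  case e_comm hn i j h h' =>
    obtain ⟨n, rfl⟩ : ∃ k, n = k + 1 := ⟨n - 1, by omega⟩
    exact insE_commute q n i j h h'
  case e_succ hn i =>
    obtain ⟨n, rfl⟩ : ∃ k, n = k + 1 := ⟨n - 1, by omega⟩
    exact insE_mul_insE_succ_mul_insE q n i
  case e_pred hn i =>
    obtain ⟨n, rfl⟩ : ∃ k, n = k + 1 := ⟨n - 1, by omega⟩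
    obtain ⟨j, rfl⟩ : ∃ j, i = j + 1 := ⟨i - 1, by ring⟩
    rw [add_sub_cancel_right]
    exact insE_mul_insE_pred_mul_insE q n j
  case rho_e i => exact insRho_mul_insE q n i
  case rho_rhoInv => exact Units.mul_inv _
  case rhoInv_rho => exact Units.inv_mul _
  case rho_sq_e hn =>
    obtain rfl : n = 0 := by omega
    -- For two strands the cyclic product has the single factor `e_1`, so the identity reads `e_1 =
    -- R² e_1`.
    have h := cyclicProd_insE_eq q 0
    have e : ((0 + 1 : ℕ) : ZMod (0 + 2)) = 1 := by simp
    have e' : (1 : ZMod (0 + 2)) + (0 : ℕ) = 1 := by simp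
    rw [cyclicProd, cyclicProd, one_mul, e, e'] at h
    exact h.symm
  case rho_e_pow hn => exact hpow

/-- Arc insertion on the Temperley-Lieb algebras. -/
noncomputable def insHom : ∀ n, TL q n →ₐ[ℂ] TL q (n + 1)
  | 0 => (Polynomial.aeval ((q : ℂ) • rho q 1 + (q : ℂ)⁻¹ • rhoInv q 1) :
      Polynomial ℂ →ₐ[ℂ] TL q 1)
  | 1 => (AddMonoidAlgebra.lift ℂ (TL q 2) ℤ
      ((Units.coeHom (TL q 2)).comp (zpowersHom _ (insRho q 0))) :
        LaurentPolynomial ℂ →ₐ[ℂ] TL q 2)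
  | n + 2 => (RingQuot.liftAlgHom ℂ ⟨FreeAlgebra.lift ℂ (insGen q n), insGen_rel q n⟩ :
      RingQuot (TLRel q (n + 2)) →ₐ[ℂ] TL q (n + 3))

lemma insHom_X : insHom q 0 (X q) = (q : ℂ) • rho q 1 + (q : ℂ)⁻¹ • rhoInv q 1 :=
  Polynomial.aeval_X (R := ℂ) (A := TL q 1) _

lemma insHom_rho (n : ℕ) : insHom q (n + 1) (rho q (n + 1)) = insRho q n := by
  cases n with
  | zero =>
    refine (AddMonoidAlgebra.lift_single _ _ _).trans ?_
    simp
  | succ n =>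
    refine (RingQuot.liftAlgHom_mkAlgHom_apply ℂ _ _ _).trans ?_
    rw [FreeAlgebra.lift_ι_apply]; rfl

lemma insHom_rhoInv (n : ℕ) : insHom q (n + 1) (rhoInv q (n + 1)) =
    ((insRho q n)⁻¹ : (TL q (n + 2))ˣ) := by
  cases n with
  | zero =>
    refine (AddMonoidAlgebra.lift_single _ _ _).trans ?_
    simp
  | succ n =>
    refine (RingQuot.liftAlgHom_mkAlgHom_apply ℂ _ _ _).trans ?_
    rw [FreeAlgebra.lift_ι_apply]; rfl

lemma insHom_e (n : ℕ) (i : ZMod (n + 2)) : insHom q (n + 2) (e q (n + 2) i) = insE q n i := by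
  refine (RingQuot.liftAlgHom_mkAlgHom_apply ℂ _ _ _).trans ?_
  rw [FreeAlgebra.lift_ι_apply]; rfl

end TL

/-! ### Algebra maps out of `TL_n` are determined by few generators -/

namespace TL

variable {q : ℂˣ} {B : Type*} [Ring B] [Algebra ℂ B]

lemma algHom_ext_zero {f g : TL q 0 →ₐ[ℂ] B} (h : f (X q) = g (X q)) : f = g :=
  Polynomial.algHom_ext (R := ℂ) (f := f) (g := g) h

lemma algHom_ext_one {f g : TL q 1 →ₐ[ℂ] B} (h : f (rho q 1) = g (rho q 1)) : f = g := by
  refine AddMonoidAlgebra.algHom_ext' (A := ℂ) (M := ℤ) (φ₁ := f) (φ₂ := g) ?_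
    (AlgHom.ext fun c => ?_)
  · exact MonoidHom.ext_mint h
  · exact (AlgHom.commutes f c).trans (AlgHom.commutes g c).symm

lemma e_succ (n : ℕ) (i : ZMod (n + 2)) :
    e q (n + 2) (i + 1) = rho q (n + 2) * e q (n + 2) i * rhoInv q (n + 2) := by
  rw [rho_mul_e, mul_assoc,
    show rho q (n + 2) * rhoInv q (n + 2) = 1 from (rhoUnit q n).val_inv, mul_one]

/-- Conjugation by `ρ` reaches every `e_i` from `e_1`. This spares any diagram computation for the
generator that crosses the seam. -/
lemma algHom_ext_add_two {n : ℕ} {f g : TL q (n + 2) →ₐ[ℂ] B}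
    (he : f (e q (n + 2) 1) = g (e q (n + 2) 1)) (hr : f (rho q (n + 2)) = g (rho q (n + 2)))
    (hr' : f (rhoInv q (n + 2)) = g (rhoInv q (n + 2))) : f = g := by
  have he' : ∀ i, f (e q (n + 2) i) = g (e q (n + 2) i) := by
    refine zmod_induction 1 he fun i hi => ?_
    rw [e_succ]
    simp only [map_mul, hi, hr, hr']
  refine RingQuot.ringQuot_ext' ℂ (f := f) (g := g) (FreeAlgebra.hom_ext (funext fun x => ?_))
  cases x with
  | e i => exact he' i
  | rho => exact hr
  | rhoInv => exact hr'

end TL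

/-! ### Comparison with arc insertion of diagrams -/

section Compatibility

variable (q : ℂˣ)

lemma clE_top (n : ℕ) : clE q n ((n + 1 : ℕ) : ZMod (n + 2)) = sk q (capCup n 0 rfl) := by
  rw [clE, eDiagram_pos n n 0 _ (ZMod.val_natCast_of_lt (by omega)) rfl]

lemma toSkein_braidElt (n : ℕ) :
    toSkein q (n + 2) (braidElt q (TL.e q (n + 2) ((n + 1 : ℕ) : ZMod (n + 2)))) =
      sk q (piece ccwOver n 0 : Diagram (n + 2) (n + 2)) := by
  have h := clE_top q n
  rw [clE] at h
  rw [braidElt, map_add, map_smul, map_smul, map_one, toSkein_e, h,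
    sk_ccwOver q n 0 (k := n) rfl rfl, ← sk_comp, Units.val_inv_eq_inv_val]
  exact add_comm _ _

lemma toSkein_braidEltInv (n : ℕ) :
    toSkein q (n + 2) (braidEltInv q (TL.e q (n + 2) ((n + 1 : ℕ) : ZMod (n + 2)))) =
      sk q (piece cwOver n 0 : Diagram (n + 2) (n + 2)) := by
  have h := clE_top q n
  rw [clE] at h
  rw [braidEltInv, map_add, map_smul, map_smul, map_one, toSkein_e, h,
    sk_cwOver q n 0 (k := n) rfl rfl, ← sk_comp, Units.val_inv_eq_inv_val]
  rfl

lemma arcInsertionHom_sk {n : ℕ} (D : Diagram n n) :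
    arcInsertionHom q n (sk q D) = sk q (ins D) := arcInsertion_sk q D

/-- The inserted arc lies under the strand crossing the seam, just inside the rotation. The product
in `EndS` puts its right factor inside, which is why the crossing stands to the right of `ρ`. -/
lemma toSkein_insRho (n : ℕ) : toSkein q (n + 2) (TL.insRho q n) =
    arcInsertionHom q (n + 1) (toSkein q (n + 1) (TL.rho q (n + 1))) := by
  rw [toSkein_rho q (n + 1) n.succ_pos, arcInsertionHom_sk, ins_seamCcw, sk_comp,
    TL.coe_insRho, map_mul, toSkein_braidElt, toSkein_rho q (n + 2) (by omega)]
  rfl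

lemma toSkein_inv_insRho (n : ℕ) :
    toSkein q (n + 2) ((TL.insRho q n)⁻¹ : (TL q (n + 2))ˣ) =
      arcInsertionHom q (n + 1) (toSkein q (n + 1) (TL.rhoInv q (n + 1))) := by
  rw [toSkein_rhoInv q (n + 1) n.succ_pos, arcInsertionHom_sk, ins_seamCw, sk_comp,
    TL.coe_inv_insRho, map_mul, toSkein_braidEltInv, toSkein_rhoInv q (n + 2) (by omega)]
  rfl

/-- The curve passes over the arc exactly once. Each smoothing of this crossing merges curve and arc
into a single strand winding once around the hole, counterclockwise for the coefficient `q` and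
clockwise for `q⁻¹`. -/
lemma sk_ins_loopDiagram : sk q (ins loopDiagram) =
    (q : ℂ) • sk q (seamCcw Nat.one_pos) + (q : ℂ)⁻¹ • sk q (seamCw Nat.one_pos) := by
  have hl := sk_move q (PlanarMove.zigzag_left 0 0 (m := 1) (k := 3) rfl rfl)
  have hr := sk_move q (PlanarMove.zigzag_right 0 0 (m := 1) (k := 3) rfl rfl)
  have hcup := sk_seam_piece q cup 0 0 (m := 1) (n := 3) rfl rfl
  have hcap := sk_seam_piece q cap 0 0 (m := 3) (n := 1) rfl rfl
  have hsc := sk_move q (PlanarMove.seam_cup 1 (n := 3) rfl)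
  simp only [sk_comp, sk_id] at hl hr hsc
  -- The term with coefficient `q`: the minimum is moved past the seam rotation, where it cancels
  -- against the maximum.
  have h1 : sk q (piece cup 0 1 : Diagram 1 3) ≫ sk q (seamCcw (n := 3) (by omega)) ≫
      sk q (piece cap 0 1 : Diagram 3 1) = sk q (seamCcw Nat.one_pos) := by
    rw [← Category.assoc]
    refine (congrArg (· ≫ _) hcup).trans ?_
    rw [Category.assoc]
    exact (congrArg (_ ≫ ·) hl).trans (Category.comp_id _)
  have h2 : sk q (piece cup 1 0 : Diagram 1 3) ≫ sk q (seamCcw (n := 3) (by omega)) ≫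
      sk q (piece cap 0 1 : Diagram 3 1) = sk q (seamCw Nat.one_pos) := by
    -- Rewriting the maximum this way supplies a second counterclockwise rotation. Two of them carry
    -- the minimum through the seam, after which it cancels against the maximum and only the
    -- clockwise rotation survives.
    have h3 : sk q (piece cap 0 1 : Diagram 3 1) = sk q (seamCcw (n := 3) (by omega)) ≫
        sk q (piece cap 1 0 : Diagram 3 1) ≫ sk q (seamCw Nat.one_pos) := by
      have h4 := hcap =≫ sk q (seamCw Nat.one_pos)
      rw [Category.assoc, Category.assoc, sk_seam_inv, Category.comp_id] at h4
      exact h4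
    rw [h3]
    have h5 := (hsc =≫ sk q (piece cap 1 0 : Diagram 3 1)).trans hr
    simp only [Category.assoc] at h5
    have h6 := h5 =≫ sk q (seamCw Nat.one_pos)
    simp only [Category.assoc, Category.id_comp] at h6
    exact h6
  have h0 : sk q (piece cup 0 1 : Diagram 1 3) ≫ sk q (piece cap 1 0 : Diagram 3 1) =
      𝟙 (skOb q 1) := hr
  have hx := sk_ccwOver q 1 0 (n := 3) (k := 1) rfl rfl
  rw [loopDiagram, ins_comp, ins_comp, ins_piece, ins_piece, ins_seamCcw]
  simp only [sk_comp, Category.assoc]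
  refine (congrArg (fun z => sk q (piece cup 0 1 : Diagram 1 3) ≫ z ≫
    sk q (seamCcw (n := 3) (by omega)) ≫ sk q (piece cap 0 1 : Diagram 3 1)) hx).trans ?_
  simp only [Preadditive.add_comp, Preadditive.comp_add, Linear.smul_comp, Linear.comp_smul,
    Category.id_comp, Category.assoc, h1, h2, Units.val_inv_eq_inv_val]
  rw [← Category.assoc, h0, Category.id_comp]

lemma toSkein_insHom (n : ℕ) (x : TL q n) :
    toSkein q (n + 1) (TL.insHom q n x) = arcInsertionHom q n (toSkein q n x) := by
  suffices h : (toSkein q (n + 1)).comp (TL.insHom q n) =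
      (arcInsertionHom q n).comp (toSkein q n) from AlgHom.congr_fun h x
  match n with
  | 0 =>
    refine TL.algHom_ext_zero ?_
    rw [AlgHom.comp_apply, AlgHom.comp_apply, TL.insHom_X, toSkein_X, arcInsertionHom_sk,
      sk_ins_loopDiagram, map_add, map_smul, map_smul, toSkein_rho q 1 Nat.one_pos,
      toSkein_rhoInv q 1 Nat.one_pos]
  | 1 =>
    refine TL.algHom_ext_one ?_
    exact (congrArg (toSkein q 2) (TL.insHom_rho q 0)).trans (toSkein_insRho q 0)
  | n + 2 =>
    refine TL.algHom_ext_add_two ?_ ?_ ?_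
    -- The diagram of `e_1` does not meet the seam, so insertion merely adds one straight strand at
    -- the end.
    · rw [AlgHom.comp_apply, AlgHom.comp_apply, TL.insHom_e, TL.insE_one, toSkein_e q n 1,
        arcInsertionHom_sk]
      refine (toSkein_e q (n + 1) 1).trans ?_
      change clE q (n + 1) 1 = _
      rw [clE_one, eDiagram_pos n 0 n 1 (zmod_val_one n) (by omega), capCup, capCup, ins_comp,
        ins_piece, ins_piece]
    · exact (congrArg (toSkein q (n + 3)) (TL.insHom_rho q (n + 1))).trans
        (toSkein_insRho q (n + 1))
    · exact (congrArg (toSkein q (n + 3)) (TL.insHom_rhoInv q (n + 1))).trans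
        (toSkein_inv_insRho q (n + 1))

end Compatibility

end AnnularSkein

/-! ### The theorem -/

open AnnularSkein
theorem mainTheorem7 (q : ℂˣ) :
    ∃ I : ∀ n : ℕ, TL q n →ₐ[ℂ] TL q (n + 1),
      -- the maps are arc insertion, under the maps from TL to the skein algebras
      (∀ (n : ℕ) (x : TL q n),
        toSkein q (n + 1) (I n x) = arcInsertionHom q n (toSkein q n x)) ∧
      I 0 (TL.X q) = (q : ℂ) • TL.rho q 1 + (q : ℂ)⁻¹ • TL.rhoInv q 1 ∧
      I 1 (TL.rho q 1) = TL.rho q 2 * ((q : ℂ)⁻¹ • TL.e q 2 1 + (q : ℂ) • 1) ∧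
      I 1 (TL.rhoInv q 1) = ((q : ℂ) • TL.e q 2 1 + (q : ℂ)⁻¹ • 1) * TL.rhoInv q 2 ∧
      ∀ n : ℕ, 2 ≤ n →
        (∀ i : ℕ, 1 ≤ i → i < n →
          I n (TL.e q n (i : ZMod n)) = TL.e q (n + 1) (i : ZMod (n + 1))) ∧
        I n (TL.e q n (n : ZMod n)) =
          ((q : ℂ) • TL.e q (n + 1) (n : ZMod (n + 1)) + (q : ℂ)⁻¹ • 1) *
            TL.e q (n + 1) ((n + 1 : ℕ) : ZMod (n + 1)) *
            ((q : ℂ)⁻¹ • TL.e q (n + 1) (n : ZMod (n + 1)) + (q : ℂ) • 1) ∧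
        I n (TL.rho q n) =
          TL.rho q (n + 1) *
            ((q : ℂ)⁻¹ • TL.e q (n + 1) (n : ZMod (n + 1)) + (q : ℂ) • 1) ∧
        I n (TL.rhoInv q n) =
          ((q : ℂ) • TL.e q (n + 1) (n : ZMod (n + 1)) + (q : ℂ)⁻¹ • 1) *
            TL.rhoInv q (n + 1) := by
  have h1 : ((0 + 1 : ℕ) : ZMod (0 + 2)) = 1 := by simp
  refine ⟨TL.insHom q, toSkein_insHom q, TL.insHom_X q, ?_, ?_, fun n hn => ?_⟩
  · refine (TL.insHom_rho q 0).trans ?_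
    rw [TL.coe_insRho, h1]
    rfl
  · refine (TL.insHom_rhoInv q 0).trans ?_
    rw [TL.coe_inv_insRho, h1]
    rfl
  · obtain ⟨n, rfl⟩ : ∃ k, n = k + 2 := ⟨n - 2, by omega⟩
    refine ⟨fun i hi hi' => ?_, ?_, ?_, ?_⟩
    · exact (TL.insHom_e q n i).trans (TL.insE_natCast q n i hi hi')
    · refine (TL.insHom_e q n _).trans (TL.insE_of_val_eq_zero q n _ ?_)
      -- The index `n` is 0 modulo `n`, which selects the conjugated image.
      rw [ZMod.natCast_self, ZMod.val_zero]
    · exact TL.insHom_rho q (n + 1)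
    · exact TL.insHom_rhoInv q (n + 1)
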